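/- Let $n,k\ge 1$, let $\mathcal O_{\mathbb C^n,0}$ be the ring of germs of holomorphic functions at $0\in\mathbb C^n$ (convergent power series), and let $g_1,\dots,g_k\in\mathcal O_{\mathbb C^n,0}$, $g_i=\sum_q c_{iq}z^q$, be germs with $g_i(0)=0$ which define a complete intersection $(Y,0)\subset(\mathbb C^n,0)$, i.e. $\dim(Y,0)=n-k$, where $\mathcal O_{Y,0}=\mathcal O_{\mathbb C^n,0}/(g_1,\dots,g_k)$. Suppose that every $g_i$ is convenient, i.e. for every $m\in\{1,\dots,n\}$ it contains, with non-zero coefficient, a monomial $z_m^l$ with $l\ge1$. Let $\Delta$ be the Newton polyhedron of $g_1\cdots g_k$, i.e. the convex hull of $\operatorname{supp}(g_1\cdots g_k)+\mathbb R_{\ge0}^n$, and let $p_1,\dots,p_r\in\mathbb N^n$ (without repetition) be the primitive vectors (with relatively prime components) orthogonal to the compact facets (faces of dimension $n-1$) of $\Delta$. Let $\nu_{ij}$ be the minimum of $\langle p_j,q\rangle$ over all monomials $z^q$ occurring in $g_i$, $\nu_i=(\nu_{i1},\dots,\nu_{ir})$, and $p^l=(p_{1l},\dots,p_{rl})$ for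 $l=1,\dots,n$, where $p_{jl}$ is the $l$-th component of $p_j$. For $1\le j_1<\dots<j_s\le r$ let $\mathrm{in}_{j_1,\dots,j_s}g_i$ be the sum of those terms $c_{iq}z^q$ of $g_i$ with $\langle p_{j_1},q\rangle=\nu_{ij_1},\dots,\langle p_{j_s},q\rangle=\nu_{ij_s}$. For $\mu\in\mathbb Z^r$ let $F_\mu\mathcal O_{\mathbb C^n,0}$ be the ideal generated by all $z^q$ with $\langle p_j,q\rangle\ge\mu_j$ for all $j$, and let $F_\mu\mathcal O_{Y,0}$ be its image in $\mathcal O_{Y,0}$. For such a filtration $F$ for which all $F_\mu/F_{\mu+\mathbf 1}$, $\mathbf 1=(1,\dots,1)$, have finite dimension, put $L(t)=\sum_{\mu\in\mathbb Z^r}\dim_{\mathbb C}(F_\mu/F_{\mu+\mathbf 1})\,t^\mu$, where $t=(t_1,\dots,t_r)$. The Poincaré series of $F$ is the power series $P(t)\in\mathbb Z[[t_1,\dots,t_r]]$ with $(t_1\cdots t_r-1)P(t)=(t_1-1)\cdots(t_r-1)L(t)$. **Theorem.** Assume that for all $s\ge1$ and $1\le j_1<\dots<j_s\le r$ the germs $\mathrm{in}_{j_1,\dots,j_s}g_1,\dots,\mathrm{in}_{j_1,\dots,j_s}g_k$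 define a subspace of $(\mathbb C^n,0)$ of codimension $\ge k-s+1$. Then for both filtrations the quotients $F_\mu/F_{\mu+\mathbf 1}$ have finite dimension and the Poincaré series exist, and $$P_{\mathcal O_{\mathbb C^n,0}}(t)=\prod_{l=1}^n\frac1{1-t^{p^l}},\qquad P_{\mathcal O_{Y,0}}(t)=(1-t^{\nu_1})\cdots(1-t^{\nu_k})\prod_{l=1}^n\frac1{1-t^{p^l}}.$$ -/

import Mathlib

noncomputable section

namespace NewtonFiltration

/-! ### The local ring of convergent power series -/

/-- A formal power series converges near the origin if it converges absolutely on some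
polydisc of positive radius. -/
def IsConvergent {n : ℕ} (f : MvPowerSeries (Fin n) ℂ) : Prop :=
  ∃ R : ℝ, 0 < R ∧ Summable fun q : Fin n →₀ ℕ => ‖MvPowerSeries.coeff q f‖ * R ^ q.degree

theorem IsConvergent.of_le {n : ℕ} {f : MvPowerSeries (Fin n) ℂ} {R R' : ℝ} (hR' : 0 ≤ R')
    (h : R' ≤ R)
    (hf : Summable fun q : Fin n →₀ ℕ => ‖MvPowerSeries.coeff q f‖ * R ^ q.degree) :
    Summable fun q : Fin n →₀ ℕ => ‖MvPowerSeries.coeff q f‖ * R' ^ q.degree :=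
  hf.of_nonneg_of_le (fun q => by positivity) (fun q => by gcongr)

/-- If the coefficients of `f` are bounded by those of a convergent series, `f` converges. -/
theorem IsConvergent.mono {n : ℕ} {f g : MvPowerSeries (Fin n) ℂ} (hg : IsConvergent g)
    (h : ∀ q, ‖MvPowerSeries.coeff q f‖ ≤ ‖MvPowerSeries.coeff q g‖) : IsConvergent f := by
  obtain ⟨R, hR, hs⟩ := hg
  exact ⟨R, hR, hs.of_nonneg_of_le (fun q => by positivity)
    (fun q => mul_le_mul_of_nonneg_right (h q) (by positivity))⟩

theorem IsConvergent.add {n : ℕ} {f g : MvPowerSeries (Fin n) ℂ} (hf : IsConvergent f)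
    (hg : IsConvergent g) : IsConvergent (f + g) := by
  obtain ⟨R, hR, hs⟩ := hf
  obtain ⟨R', hR', hs'⟩ := hg
  refine ⟨min R R', lt_min hR hR', ?_⟩
  have h1 := IsConvergent.of_le (le_of_lt (lt_min hR hR')) (min_le_left R R') hs
  have h2 := IsConvergent.of_le (le_of_lt (lt_min hR hR')) (min_le_right R R') hs'
  have h0 : 0 < min R R' := lt_min hR hR'
  refine (h1.add h2).of_nonneg_of_le (fun q => by positivity) (fun q => ?_)
  rw [← add_mul, map_add]
  exact mul_le_mul_of_nonneg_right (norm_add_le _ _) (by positivity)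

theorem IsConvergent.mul {n : ℕ} {f g : MvPowerSeries (Fin n) ℂ} (hf : IsConvergent f)
    (hg : IsConvergent g) : IsConvergent (f * g) := by
  obtain ⟨R, hR, hs⟩ := hf
  obtain ⟨R', hR', hs'⟩ := hg
  have h0 : 0 < min R R' := lt_min hR hR'
  refine ⟨min R R', h0, ?_⟩
  have h1 := IsConvergent.of_le h0.le (min_le_left R R') hs
  have h2 := IsConvergent.of_le h0.le (min_le_right R R') hs'
  set a : (Fin n →₀ ℕ) → ℝ := fun q => ‖MvPowerSeries.coeff q f‖ * (min R R') ^ q.degree with ha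
  set b : (Fin n →₀ ℕ) → ℝ := fun q => ‖MvPowerSeries.coeff q g‖ * (min R R') ^ q.degree with hb
  have ha0 : ∀ q, 0 ≤ a q := fun q => by rw [ha]; positivity
  have hb0 : ∀ q, 0 ≤ b q := fun q => by rw [hb]; positivity
  have h4 : Summable fun x : (Fin n →₀ ℕ) × (Fin n →₀ ℕ) => a x.1 * b x.2 :=
    h1.mul_of_nonneg h2 ha0 hb0
  have h3 : Summable fun q : Fin n →₀ ℕ => ∑ kl ∈ Finset.HasAntidiagonal.antidiagonal q, a kl.1 * b kl.2 :=
    summable_sum_mul_antidiagonal_of_summable_mul h4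
  refine h3.of_nonneg_of_le (fun q => by positivity) (fun q => ?_)
  rw [MvPowerSeries.coeff_mul]
  refine (mul_le_mul_of_nonneg_right (norm_sum_le _ _) (by positivity)).trans ?_
  rw [Finset.sum_mul]
  refine Finset.sum_le_sum fun x hx => ?_
  rw [← Finset.HasAntidiagonal.mem_antidiagonal.mp hx, map_add, pow_add, norm_mul]
  exact le_of_eq (by simp only [ha, hb]; ring)

theorem isConvergent_monomial {n : ℕ} (q : Fin n →₀ ℕ) (c : ℂ) :
    IsConvergent (MvPowerSeries.monomial q c) := by
  classical
  refine ⟨1, one_pos, summable_of_ne_finset_zero (s := {q}) fun b hb => ?_⟩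
  rw [MvPowerSeries.coeff_monomial, if_neg (by simpa using hb)]
  simp

/-- The ring `𝒪_{ℂⁿ,0}` of germs of holomorphic functions at the origin of `ℂⁿ`, realized as the
ring `ℂ{z₁,…,zₙ}` of convergent power series. -/
def HoloGerm (n : ℕ) : Subalgebra ℂ (MvPowerSeries (Fin n) ℂ) where
  carrier := {f | IsConvergent f}
  mul_mem' := IsConvergent.mul
  add_mem' := IsConvergent.add
  algebraMap_mem' c := isConvergent_monomial 0 c

/-- The coefficient of `z^q` in the power series expansion of a germ. -/
def germCoeff {n : ℕ} (q : Fin n →₀ ℕ) (f : HoloGerm n) : ℂ :=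
  MvPowerSeries.coeff q (f : MvPowerSeries (Fin n) ℂ)

/-- The monomial `z^q` as a germ. -/
def monomialGerm {n : ℕ} (q : Fin n →₀ ℕ) : HoloGerm n :=
  ⟨MvPowerSeries.monomial q 1, isConvergent_monomial q 1⟩

/-- The set of exponents of the monomials that occur in a germ. -/
def supp {n : ℕ} (f : HoloGerm n) : Set (Fin n →₀ ℕ) :=
  {q | germCoeff q f ≠ 0}

/-- A germ is convenient if for every coordinate `zᵢ` it contains a monomial `zᵢ^l` with
`l ≥ 1`. -/
def IsConvenient {n : ℕ} (f : HoloGerm n) : Prop :=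
  ∀ i : Fin n, ∃ l : ℕ, 0 < l ∧ Finsupp.single i l ∈ supp f

/-! ### Dimension of germs of analytic sets -/

/-- The germ at `0` of the zero set of the ideal `I` has codimension at least `c` in `(ℂⁿ,0)`:
its dimension, i.e. the Krull dimension of its local ring, is at most `n - c`. -/
def CodimAtLeast {n : ℕ} (I : Ideal (HoloGerm n)) (c : ℤ) : Prop :=
  ∀ d : ℕ, (d : WithBot ℕ∞) ≤ ringKrullDim (HoloGerm n ⧸ I) → c ≤ (n : ℤ) - d

/-- The germs `g₁,…,g_k` vanish at `0` and define a complete intersection in `(ℂⁿ,0)`: the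
dimension of the germ they define is `n - k`. -/
def IsCompleteIntersection {n k : ℕ} (g : Fin k → HoloGerm n) : Prop :=
  (∀ i, germCoeff 0 (g i) = 0) ∧
    ringKrullDim (HoloGerm n ⧸ Ideal.span (Set.range g)) + (k : WithBot ℕ∞) = (n : WithBot ℕ∞)

/-! ### The Newton polyhedron -/

/-- The Newton polyhedron of a germ: the convex hull of `supp f + ℝ₊ⁿ`. -/
def newtonPolyhedron {n : ℕ} (f : HoloGerm n) : Set (Fin n → ℝ) :=
  convexHull ℝ {x | ∃ q ∈ supp f, ∀ i, (q i : ℝ) ≤ x i}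

/-- The face of `Δ` on which the linear form `⟨p, ·⟩` attains its minimum over `Δ`. -/
def face {n : ℕ} (Δ : Set (Fin n → ℝ)) (p : Fin n → ℕ) : Set (Fin n → ℝ) :=
  {x ∈ Δ | ∀ y ∈ Δ, ∑ i, (p i : ℝ) * x i ≤ ∑ i, (p i : ℝ) * y i}

/-- The primitive vectors in `ℕⁿ` orthogonal to the compact facets (faces of dimension `n - 1`)
of `Δ`. -/
def compactFacetNormals {n : ℕ} (Δ : Set (Fin n → ℝ)) : Set (Fin n → ℕ) :=
  {p | Finset.univ.gcd p = 1 ∧ (face Δ p).Nonempty ∧ IsCompact (face Δ p) ∧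
    Module.finrank ℝ (vectorSpan ℝ (face Δ p)) + 1 = n}

/-- The pairing `⟨p, q⟩` of a weight vector with an exponent. -/
def pairing {n : ℕ} (p : Fin n → ℕ) (q : Fin n →₀ ℕ) : ℕ := ∑ i, p i * q i

/-- The largest `m` such that `⟨p, q⟩ ≥ m` for all monomials `z^q` that occur in `f`, i.e. the
minimum of `⟨p, q⟩` over these monomials (for `f ≠ 0`). -/
def weightOrder {n : ℕ} (p : Fin n → ℕ) (f : HoloGerm n) : ℕ :=
  sInf (pairing p '' supp f)

open Classical in
/-- The initial part of `f` with respect to the weight vectors `p_j`, `j ∈ J`: keep the terms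
`c_q z^q` for which `⟨p_j, q⟩` is minimal on `supp f` for all `j ∈ J`. -/
def initialPart {n r : ℕ} (p : Fin r → Fin n → ℕ) (J : Finset (Fin r)) (f : HoloGerm n) :
    HoloGerm n :=
  ⟨fun q => if ∀ j ∈ J, pairing (p j) q = weightOrder (p j) f then germCoeff q f else 0,
    IsConvergent.mono f.2 fun q => by
      change ‖if _ then _ else _‖ ≤ _
      split_ifs
      · exact le_refl _
      · simp⟩

/-! ### Multi-index filtrations and their Poincaré series -/

/-- The ideal `F_μ 𝒪_{ℂⁿ,0}` generated by all monomials `z^q` with `⟨p_l, q⟩ ≥ μ_l` for all `l`. -/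
def ambientFiltration {n r : ℕ} (p : Fin r → Fin n → ℕ) (μ : Fin r → ℤ) : Ideal (HoloGerm n) :=
  Ideal.span {f | ∃ q : Fin n →₀ ℕ, (∀ l, μ l ≤ (pairing (p l) q : ℤ)) ∧ f = monomialGerm q}

/-- The local ring `𝒪_{Y,0}` of the germ `Y` defined by `g₁,…,g_k`. -/
abbrev LocalRingOf {n k : ℕ} (g : Fin k → HoloGerm n) : Type :=
  HoloGerm n ⧸ Ideal.span (Set.range g)

/-- The induced filtration: `F_μ 𝒪_{Y,0}` is the image of `F_μ 𝒪_{ℂⁿ,0}` in `𝒪_{Y,0}`. -/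
def inducedFiltration {n r k : ℕ} (p : Fin r → Fin n → ℕ) (g : Fin k → HoloGerm n)
    (μ : Fin r → ℤ) : Ideal (LocalRingOf g) :=
  (ambientFiltration p μ).map (Ideal.Quotient.mk (Ideal.span (Set.range g)))

/-- The quotient `F_μ / F_{μ+𝟏}`, where `𝟏 = (1,…,1)`. -/
abbrev GradedPiece {A : Type*} [CommRing A] {r : ℕ} (F : (Fin r → ℤ) → Ideal A)
    (μ : Fin r → ℤ) : Type _ :=
  F μ ⧸ (F (μ + 1)).submoduleOf (F μ)

/-- The coefficient of `t^μ`, `μ ∈ ℤ^r`, in a power series regarded as a Laurent series. -/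
def laurentCoeff {r : ℕ} (P : MvPowerSeries (Fin r) ℤ) (μ : Fin r → ℤ) : ℤ :=
  if ∀ j, 0 ≤ μ j then
    MvPowerSeries.coeff (Finsupp.equivFunOnFinite.symm fun j => (μ j).toNat) P
  else 0

/-- `P ∈ ℤ[[t₁,…,t_r]]` is the Poincaré series of the filtration `F`: all quotients
`F_μ / F_{μ+𝟏}` have finite dimension over `ℂ` and, with
`L(t) = ∑_{μ ∈ ℤ^r} dim (F_μ / F_{μ+𝟏}) t^μ`,
one has `(t₁⋯t_r - 1) P(t) = (t₁ - 1)⋯(t_r - 1) L(t)`, which is written out here coefficient by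
coefficient at every `t^μ`, `μ ∈ ℤ^r`. -/
def HasPoincareSeries {A : Type*} [CommRing A] [Algebra ℂ A] {r : ℕ}
    (F : (Fin r → ℤ) → Ideal A) (P : MvPowerSeries (Fin r) ℤ) : Prop :=
  (∀ μ, Module.Finite ℂ (GradedPiece F μ)) ∧
    ∀ μ : Fin r → ℤ, laurentCoeff P (μ - 1) - laurentCoeff P μ =
      ∑ S : Finset (Fin r), (-1) ^ Sᶜ.card *
        (Module.finrank ℂ (GradedPiece F (fun j => μ j - if j ∈ S then 1 else 0)) : ℤ)

/-- For `r ≥ 1` a filtration has at most one Poincaré series. -/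
theorem HasPoincareSeries.unique {A : Type*} [CommRing A] [Algebra ℂ A] {r : ℕ} (hr : 0 < r)
    {F : (Fin r → ℤ) → Ideal A} {P Q : MvPowerSeries (Fin r) ℤ} (hP : HasPoincareSeries F P)
    (hQ : HasPoincareSeries F Q) : P = Q := by
  have hstep : ∀ (m : ℕ) (μ : Fin r → ℤ), laurentCoeff P μ - laurentCoeff Q μ =
      laurentCoeff P (μ - (m : Fin r → ℤ)) - laurentCoeff Q (μ - (m : Fin r → ℤ)) := by
    intro m
    induction m with
    | zero => intro μ; simp
    | succ m ih =>
      intro μ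
      have h1 := hP.2 (μ - (m : Fin r → ℤ))
      have h2 := hQ.2 (μ - (m : Fin r → ℤ))
      rw [← h2] at h1
      rw [ih μ, Nat.cast_succ, ← sub_sub]
      linarith
  ext q
  have key := hstep (q ⟨0, hr⟩ + 1) (fun j => (q j : ℤ))
  have hneg : ∀ P : MvPowerSeries (Fin r) ℤ, laurentCoeff P
      ((fun j => (q j : ℤ)) - ((q ⟨0, hr⟩ + 1 : ℕ) : Fin r → ℤ)) = 0 := by
    intro P
    refine if_neg fun h => ?_
    have := h ⟨0, hr⟩
    simp at this
  have hpos : ∀ P : MvPowerSeries (Fin r) ℤ, laurentCoeff P (fun j => (q j : ℤ)) =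
      MvPowerSeries.coeff q P := by
    intro P
    rw [laurentCoeff, if_pos fun j => Int.natCast_nonneg _]
    congr 2
    ext j
    simp
  rw [hneg, hneg, hpos, hpos] at key
  linarith

/-- The power series `t^a`. -/
def tPow {r : ℕ} (a : Fin r → ℕ) : MvPowerSeries (Fin r) ℤ :=
  MvPowerSeries.monomial (Finsupp.equivFunOnFinite.symm a) 1

/-- The series `∏_{i=1}^n 1 / (1 - t^{p^i})`, where `p^i = (p_{1i},…,p_{ri})` collects the `i`-th
components of `p₁,…,p_r`. For `p^i ≠ 0` the factor `1 - t^{p^i}` has constant term `1`, and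
`invOfUnit _ 1` is its inverse in `ℤ[[t₁,…,t_r]]`. -/
def productSeries {n r : ℕ} (p : Fin r → Fin n → ℕ) : MvPowerSeries (Fin r) ℤ :=
  ∏ i : Fin n, MvPowerSeries.invOfUnit (1 - tPow fun j => p j i) 1

end NewtonFiltration

end

/-!
Write `F_μ` for the ideal of germs all of whose exponents `q` satisfy `⟨p_j, q⟩ ≥ μ_j`. The normals
of compact facets have positive components (`pos_of_mem_compactFacetNormals`), so `F_μ` is the ideal
generated by the monomials it contains (`ambientFiltration_eq`), and `F_μ / F_{μ+𝟏}` has the finite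
basis of the `z^q` with `q ∈ gradedSupport p μ`. An inclusion-exclusion over the weights of the
monomials turns this into the formula for the ambient Poincaré series, because the coefficients of
`∏ 1 / (1 - t^{p^l})` count monomials (`isPoincareSeries_productSeries`).

For the quotient, what matters is that the classes of `g₁, …, g_k` in `⨁_μ F_μ / F_{μ+𝟏}` form a
regular sequence (`mem_sup_of_mul_mem`). The ring `⨁_μ F_μ / F_{μ+𝟏}` is the quotient by
`u = u₁ ⋯ u_r` of the Rees algebra of the filtration, and up to convergence this Rees algebra is the
polynomial ring in `Z_l = z_l t^{p^l}` and `u_j = t_j⁻¹`. Let `G_i` be the homogenization of `g_i` in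
it. A prime ideal `Q` that contains `u, G₁, …, G_k` contains `u_j` exactly for `j` in some non-empty
`J`; modulo `Q` the equations `G_i` become, after rescaling the `Z_l` by the invertible `u_j`, the
initial parts `in_J g_i`. The codimension hypothesis bounds the dimension of the space they define,
and this bounds the dimension of the quotient by `Q` by `n + r - (k + 1)`
(`ringKrullDim_quotient_prime_le`). To pass from germs to polynomials, homogeneous primes of the
polynomial ring are extended to primes of the ring of germs, and a homogeneous system of parameters
replaces the usual dimension theory (`exists_parameters_of_codimAtLeast`). Thus `u, G₁, …, G_k` is
part of a system of parameters in the local ring of the Rees algebra at the origin, which is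
Cohen–Macaulay, and so it is a regular sequence (`isRegular_of_supportDim_le`). By homogeneity the
regularity descends to the graded ring (`mem_equationIdeal_of_mul_mem`).

Regularity of the classes implies that the filtration is strict with respect to `(g₁, …, g_k)`
(`IsFilteredRegular.inf_span_le`), so the graded pieces of the induced filtration are those of the
quotient of `⨁_μ F_μ / F_{μ+𝟏}` by the classes of the `g_i`. Their dimensions follow by adding one
equation at a time: multiplication by `g_i` is injective of degree `ν_i`
(`IsFilteredRegular.finite_and_finrank_succ`), which multiplies the Poincaré series by `1 - t^{ν_i}`.
-/

noncomputable section

namespace NewtonFiltration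

/-! ### Systems of parameters in Cohen–Macaulay modules -/

section CohenMacaulay

open RingTheory.Sequence IsLocalRing
open scoped Pointwise

universe u

variable {R : Type u} [CommRing R]

theorem supportDim_mono {M N : Type*} [AddCommGroup M] [Module R M] [AddCommGroup N] [Module R N]
    (h : Module.support R M ⊆ Module.support R N) :
    Module.supportDim R M ≤ Module.supportDim R N :=
  Order.krullDim_le_of_strictMono (Set.inclusion h) fun _ _ h => h

variable [IsNoetherianRing R]

theorem notMem_associatedPrime_of_isSMulRegular {M : Type u} [AddCommGroup M] [Module R M] {x : R}
    (hx : IsSMulRegular M x) {p : Ideal R} (hp : p ∈ associatedPrimes R M) : x ∉ p := by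
  intro hxp
  have : x ∈ ⋃ p ∈ associatedPrimes R M, (p : Set R) := Set.mem_biUnion hp hxp
  rw [biUnion_associatedPrimes_eq_compl_regular] at this
  exact this hx

variable [IsLocalRing R]

/-- If `x` is `M`-regular, every associated prime of `M` is contained in an associated prime of
`M / xM` that contains `x`: by Nakayama's lemma the submodule of `M` killed by `p` is not contained
in `xM`. -/
theorem exists_associatedPrime_quotSMulTop {M : Type u} [AddCommGroup M] [Module R M]
    [Module.Finite R M] {x : R} (hx : IsSMulRegular M x) (hxm : x ∈ maximalIdeal R)
    {p : Ideal R} (hp : p ∈ associatedPrimes R M) :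
    ∃ q ∈ associatedPrimes R (QuotSMulTop x M), p ≤ q ∧ x ∈ q := by
  obtain ⟨hpp, m₀, hm₀⟩ := isAssociatedPrime_iff.mp hp
  let N : Submodule R M := Submodule.torsionBySet R M p
  have hN : ¬ N ≤ x • (⊤ : Submodule R M) := by
    intro hle
    have h1 : N ≤ Ideal.span {x} • N := by
      intro m hm
      obtain ⟨m', -, rfl⟩ := hle hm
      refine Submodule.smul_mem_smul (Ideal.mem_span_singleton_self x) ?_
      rw [Submodule.mem_torsionBySet_iff] at hm ⊢
      intro a
      have h2 : (a : R) • x • m' = 0 := hm a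
      rw [smul_comm] at h2
      exact hx (by simpa using h2)
    have h3 : N = ⊥ := Submodule.eq_bot_of_le_smul_of_le_jacobson_bot _ N
      (IsNoetherian.noetherian N) h1
      ((Ideal.span_singleton_le_iff_mem _).mpr hxm |>.trans (maximalIdeal_le_jacobson _))
    have h4 : m₀ ∈ N := by
      rw [Submodule.mem_torsionBySet_iff]
      rintro ⟨a, ha⟩
      have ha' : a ∈ p := ha
      rw [hm₀, Submodule.mem_colon_singleton] at ha'
      simpa using ha'
    rw [h3, Submodule.mem_bot] at h4
    apply hpp.ne_top
    rw [hm₀, h4]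
    ext a
    simp
  obtain ⟨m, hmN, hm⟩ := Set.not_subset.mp hN
  have hne : (Submodule.Quotient.mk m : QuotSMulTop x M) ≠ 0 := by
    rwa [Ne, Submodule.Quotient.mk_eq_zero]
  obtain ⟨q, hq, hle⟩ := exists_le_isAssociatedPrime_of_isNoetherianRing R _ hne
  refine ⟨q, hq, fun a ha => hle ?_, hle ?_⟩
  · rw [Submodule.mem_colon_singleton, ← Submodule.Quotient.mk_smul]
    have : a • m = 0 := (Submodule.mem_torsionBySet_iff _ _).mp hmN ⟨a, ha⟩
    rw [this]
    simp
  · rw [Submodule.mem_colon_singleton, ← Submodule.Quotient.mk_smul, Submodule.mem_bot,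
      Submodule.Quotient.mk_eq_zero]
    exact Submodule.smul_mem_pointwise_smul _ _ _ trivial

/-- The dimension of `R / p` at an associated prime `p` of `M` is at least the depth of `M`. -/
theorem length_le_supportDim_quotient_associatedPrime (rs : List R) :
    ∀ {M : Type u} [AddCommGroup M] [Module R M] [Module.Finite R M], IsRegular M rs →
      (∀ x ∈ rs, x ∈ maximalIdeal R) → ∀ {p : Ideal R}, p ∈ associatedPrimes R M →
      (rs.length : WithBot ℕ∞) ≤ Module.supportDim R (R ⧸ p) := by
  induction rs with
  | nil =>
    intro M _ _ _ _ _ p hp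
    have : p.IsPrime := hp.1
    have h := Module.supportDim_ne_bot_of_nontrivial R (R ⧸ p)
    obtain ⟨d, hd⟩ := WithBot.ne_bot_iff_exists.mp h
    rw [← hd]
    exact WithBot.coe_le_coe.mpr zero_le
  | cons x rs ih =>
    intro M _ _ _ hreg hmem p hp
    have hpp : p.IsPrime := hp.1
    obtain ⟨hx, hrs⟩ := (isRegular_cons_iff M x rs).mp hreg
    obtain ⟨q, hq, hpq, hxq⟩ :=
      exists_associatedPrime_quotSMulTop hx (hmem x List.mem_cons_self) hp
    have h1 := ih hrs (fun y hy => hmem y (List.mem_cons_of_mem _ hy)) hq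
    have h2 : Module.supportDim R (QuotSMulTop x (R ⧸ p)) + 1 ≤ Module.supportDim R (R ⧸ p) := by
      refine Module.supportDim_quotSMulTop_succ_le_of_notMem_minimalPrimes fun p' hp' => ?_
      rw [Ideal.annihilator_quotient, Ideal.minimalPrimes_eq_subsingleton_self] at hp'
      rw [Set.mem_singleton_iff.mp hp']
      exact notMem_associatedPrime_of_isSMulRegular hx hp
    have h3 : Module.supportDim R (R ⧸ q) ≤ Module.supportDim R (QuotSMulTop x (R ⧸ p)) := by
      refine supportDim_mono ?_
      rw [Module.support_quotSMulTop, Module.support_eq_zeroLocus, Module.support_eq_zeroLocus,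
        Ideal.annihilator_quotient, Ideal.annihilator_quotient]
      intro P hP
      exact ⟨fun a ha => hP (hpq ha), by simpa using hP hxq⟩
    calc ((x :: rs).length : WithBot ℕ∞) = (rs.length : WithBot ℕ∞) + 1 := by simp
      _ ≤ Module.supportDim R (QuotSMulTop x (R ⧸ p)) + 1 := by gcongr; exact h1.trans h3
      _ ≤ _ := h2

theorem supportDim_le_supportDim_quotient_add_length (rs : List R) :
    ∀ {M : Type u} [AddCommGroup M] [Module R M] [Module.Finite R M],
      (∀ x ∈ rs, x ∈ maximalIdeal R) →
      Module.supportDim R M ≤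
        Module.supportDim R (M ⧸ Ideal.ofList rs • (⊤ : Submodule R M)) + rs.length := by
  induction rs with
  | nil =>
    intro M _ _ _ _
    simp only [List.length_nil, Nat.cast_zero, add_zero]
    refine supportDim_mono ?_
    rw [Module.support_quotient]
    simp
  | cons x rs ih =>
    intro M _ _ _ hmem
    rw [Module.supportDim_eq_of_equiv (Submodule.quotOfListConsSMulTopEquivQuotSMulTopInner M x rs)]
    refine (Module.supportDim_le_supportDim_quotSMulTop_succ (hmem x List.mem_cons_self)).trans ?_
    have := ih (M := QuotSMulTop x M) fun y hy => hmem y (List.mem_cons_of_mem _ hy)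
    rw [List.length_cons, Nat.cast_add, Nat.cast_one, ← add_assoc]
    gcongr

open CategoryTheory Abelian Limits in
/-- Dividing by a regular element lowers the depth by one. -/
theorem exists_isRegular_quotSMulTop {M : Type u} [AddCommGroup M] [Module R M]
    [Module.Finite R M] [Nontrivial M] {x : R} (hx : IsSMulRegular M x) (hxm : x ∈ maximalIdeal R)
    {d : ℕ} (h : ∃ rs : List R, rs.length = d + 1 ∧ (∀ y ∈ rs, y ∈ maximalIdeal R) ∧
      IsRegular M rs) :
    ∃ rs : List R, rs.length = d ∧ (∀ y ∈ rs, y ∈ maximalIdeal R) ∧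
      IsRegular (QuotSMulTop x M) rs := by
  have hlt : ∀ {N : Type u} [AddCommGroup N] [Module R N] [Module.Finite R N] [Nontrivial N],
      maximalIdeal R • (⊤ : Submodule R N) < ⊤ := by
    intro N _ _ _ _
    exact (Submodule.top_ne_ideal_smul_of_le_jacobson_annihilator
      (maximalIdeal_le_jacobson _)).symm.lt_top
  have : Nontrivial (QuotSMulTop x M) := nontrivial_quotSMulTop_of_mem_maximalIdeal M hxm
  have h1 := ((ModuleCat.exists_isRegular_tfae (maximalIdeal R) (d + 1) (ModuleCat.of R M)
    hlt).out 1 3).mpr h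
  refine ((ModuleCat.exists_isRegular_tfae (maximalIdeal R) d
    (ModuleCat.of R (QuotSMulTop x M)) hlt).out 1 3).mp fun i hi => ?_
  have zero1 := AddCommGrpCat.isZero_of_iff_subsingleton.mpr (h1 i (by omega))
  have zero2 := AddCommGrpCat.isZero_of_iff_subsingleton.mpr (h1 (i + 1) (by omega))
  exact AddCommGrpCat.subsingleton_of_isZero <| ShortComplex.Exact.isZero_of_both_zeros
    ((Ext.covariant_sequence_exact₃' _
      (IsSMulRegular.smulShortComplex_shortExact (M := ModuleCat.of R M) hx)) i (i + 1) rfl)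
    (zero1.eq_zero_of_src _) (zero2.eq_zero_of_tgt _)

/-- In a module of depth `d`, elements that cut the dimension down to `d` minus their number form a
regular sequence. -/
theorem isRegular_of_supportDim_le (gs : List R) :
    ∀ {M : Type u} [AddCommGroup M] [Module R M] [Module.Finite R M] [Nontrivial M] {d : ℕ},
      (∀ x ∈ gs, x ∈ maximalIdeal R) →
      (∃ rs : List R, rs.length = d ∧ (∀ y ∈ rs, y ∈ maximalIdeal R) ∧ IsRegular M rs) →
      Module.supportDim R (M ⧸ Ideal.ofList gs • (⊤ : Submodule R M)) + gs.length ≤ d →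
      IsRegular M gs := by
  induction gs with
  | nil => intro M _ _ _ _ _ _ _ _; exact IsRegular.nil R M
  | cons a gs ih =>
    intro M _ _ _ _ d hmem hdepth hdim
    have ham := hmem a List.mem_cons_self
    have hgs : ∀ x ∈ gs, x ∈ maximalIdeal R := fun y hy => hmem y (List.mem_cons_of_mem _ hy)
    have hM' : Nontrivial (QuotSMulTop a M) := nontrivial_quotSMulTop_of_mem_maximalIdeal M ham
    set D := Module.supportDim R (M ⧸ Ideal.ofList (a :: gs) • (⊤ : Submodule R M)) with hD
    have hD' : Module.supportDim R (QuotSMulTop a M ⧸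
        Ideal.ofList gs • (⊤ : Submodule R (QuotSMulTop a M))) = D :=
      (Module.supportDim_eq_of_equiv
        (Submodule.quotOfListConsSMulTopEquivQuotSMulTopInner M a gs)).symm
    have hDnat : ∃ e : ℕ, D = e := by
      have h1 : (1 : WithBot ℕ∞) ≤ Module.supportDim R (QuotSMulTop a M) + 1 := by
        have h := Module.supportDim_ne_bot_of_nontrivial R (QuotSMulTop a M)
        obtain ⟨e, he⟩ := WithBot.ne_bot_iff_exists.mp h
        rw [← he]
        exact WithBot.coe_le_coe.mpr le_add_self
      have h2 := supportDim_le_supportDim_quotient_add_length gs (M := QuotSMulTop a M) hgs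
      rw [hD'] at h2
      have h3 : D ≠ ⊥ := by
        intro h
        rw [h, WithBot.bot_add, le_bot_iff] at h2
        exact Module.supportDim_ne_bot_of_nontrivial R (QuotSMulTop a M) h2
      obtain ⟨e, he⟩ := WithBot.ne_bot_iff_exists.mp h3
      rw [← he] at hdim ⊢
      have h4 : e + ((a :: gs).length : ℕ∞) ≤ d := WithBot.coe_le_coe.mp hdim
      have h5 : e ≠ ⊤ := by
        rintro rfl
        simp at h4
      obtain ⟨e, rfl⟩ := ENat.ne_top_iff_exists.mp h5
      exact ⟨e, rfl⟩
    obtain ⟨e, he⟩ := hDnat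
    have hed : e + (gs.length + 1) ≤ d := by
      rw [he] at hdim
      exact_mod_cast hdim
    -- if `a` lay in an associated prime `p`, the `gs.length` other elements would have to cut
    -- `R / p`, of dimension at least `d`, down to dimension `e < d - gs.length`
    have hreg : IsSMulRegular M a := by
      by_contra hnreg
      have : a ∈ ⋃ p ∈ associatedPrimes R M, (p : Set R) := by
        rw [biUnion_associatedPrimes_eq_compl_regular]
        exact hnreg
      obtain ⟨p, hp, hap⟩ := Set.mem_iUnion₂.mp this
      obtain ⟨rs, hlen, hrs, hrsreg⟩ := hdepth
      have h1 := length_le_supportDim_quotient_associatedPrime rs hrsreg hrs hp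
      have h2 := supportDim_le_supportDim_quotient_add_length gs (M := R ⧸ p) hgs
      have h3 : Module.supportDim R ((R ⧸ p) ⧸ Ideal.ofList gs • (⊤ : Submodule R (R ⧸ p))) ≤ D := by
        refine supportDim_mono ?_
        rw [Module.support_quotient, Module.support_quotient, Module.support_eq_zeroLocus,
          Ideal.annihilator_quotient]
        rintro P ⟨hP1, hP2⟩
        refine ⟨Module.mem_support_iff_of_finite.mpr fun b hb => hP1 ?_, ?_⟩
        · exact IsAssociatedPrime.annihilator_le hp (by rwa [Submodule.annihilator_top])
        · rw [Ideal.ofList_cons, PrimeSpectrum.mem_zeroLocus]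
          exact sup_le ((Ideal.span_singleton_le_iff_mem _).mpr (hP1 hap)) hP2
      have h4 : (d : WithBot ℕ∞) ≤ e + gs.length := by
        rw [← hlen]
        refine h1.trans (h2.trans ?_)
        rw [← he]
        gcongr
      have h5 : d ≤ e + gs.length := by exact_mod_cast h4
      omega
    obtain ⟨d', rfl⟩ : ∃ d', d = d' + 1 := ⟨d - 1, by omega⟩
    refine (isRegular_cons_iff M a gs).mpr
      ⟨hreg, ih hgs (exists_isRegular_quotSMulTop hreg ham hdepth) ?_⟩
    rw [hD', he]
    have : e + gs.length ≤ d' := by omega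
    exact_mod_cast this

end CohenMacaulay

/-! ### Krull dimension and transcendence degree -/

section TranscendenceDegree

theorem ringKrullDim_le_of_isIntegral {A B : Type*} [CommRing A] [CommRing B]
    (f : A →+* B) (hint : f.IsIntegral) : ringKrullDim B ≤ ringKrullDim A := by
  algebraize [f]
  have : Algebra.IsIntegral A B := ⟨hint⟩
  refine Order.krullDim_le_of_strictMono (PrimeSpectrum.comap f) fun P Q hPQ => ?_
  exact Ideal.IsIntegral.comap_lt_comap (R := A) hPQ

/-- The Krull dimension of a finitely generated domain is at most the number of elements of its
fraction field over which all its generators are algebraic. -/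
theorem ringKrullDim_le_card_of_isAlgebraic {k D K : Type} [Field k] [CommRing D] [IsDomain D]
    [Algebra k D] [Algebra.FiniteType k D] [Field K] [Algebra D K] [IsFractionRing D K]
    [Algebra k K] [IsScalarTower k D K] (S : Finset K) (T : Set D) (hT : Algebra.adjoin k T = ⊤)
    (halg : ∀ d ∈ T, IsAlgebraic (Algebra.adjoin k (S : Set K)) (algebraMap D K d)) :
    ringKrullDim D ≤ S.card := by
  obtain ⟨s, g, hg, hint⟩ := exists_integral_inj_algHom_of_fg k D
  have h1 : ringKrullDim D ≤ s := by
    refine (ringKrullDim_le_of_isIntegral (g : MvPolynomial (Fin s) k →+* D)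
      hint).trans ?_
    rw [MvPolynomial.ringKrullDim_of_isNoetherianRing, ringKrullDim_eq_zero_of_field]
    simp
  have hD : ∀ d : D, IsAlgebraic (Algebra.adjoin k (S : Set K)) (algebraMap D K d) := by
    intro d
    have hd : d ∈ Algebra.adjoin k T := hT ▸ Algebra.mem_top
    induction hd using Algebra.adjoin_induction with
    | mem x hx => exact halg x hx
    | algebraMap r =>
      rw [← IsScalarTower.algebraMap_apply k D K,
        IsScalarTower.algebraMap_apply k (Algebra.adjoin k (S : Set K)) K]
      exact isAlgebraic_algebraMap _
    | add x y _ _ hx hy => rw [map_add]; exact hx.add hy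
    | mul x y _ _ hx hy => rw [map_mul]; exact hx.mul hy
  have hK : Algebra.IsAlgebraic (Algebra.adjoin k (S : Set K)) K := by
    refine ⟨fun x => ?_⟩
    obtain ⟨a, b, -, rfl⟩ := IsFractionRing.div_surjective (A := D) x
    rw [div_eq_mul_inv]
    exact (hD a).mul (hD b).inv
  have h2 : AlgebraicIndependent k fun i : Fin s => algebraMap D K (g (MvPolynomial.X i)) := by
    let φ : MvPolynomial (Fin s) k →ₐ[k] K := (IsScalarTower.toAlgHom k D K).comp g
    have hφ : MvPolynomial.aeval (fun i : Fin s => algebraMap D K (g (MvPolynomial.X i))) = φ := by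
      ext i
      simp [φ]
    rw [AlgebraicIndependent, hφ]
    exact (FaithfulSMul.algebraMap_injective D K).comp hg
  have h3 := h2.cardinalMk_le_trdeg.trans (Algebra.IsAlgebraic.trdeg_le_cardinalMk k (S : Set K))
  have h4 : s ≤ S.card := by
    have : (s : Cardinal.{0}) ≤ (S.card : Cardinal.{0}) := by simpa using h3
    exact_mod_cast this
  exact h1.trans (by exact_mod_cast h4)

end TranscendenceDegree

/-! ### Homogeneous systems of parameters -/

section HomogeneousParameters

variable {A σ : Type*} [CommRing A] [SetLike σ A] [AddSubmonoidClass σ A] {𝒜 : ℕ → σ}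
  [GradedRing 𝒜]

/-- A homogeneous ideal not contained in an ideal `P` has a homogeneous element outside `P`. -/
theorem exists_homogeneous_mem_notMem {Q P : Ideal A} (hQ : Q.IsHomogeneous 𝒜) (h : ¬ Q ≤ P) :
    ∃ d : ℕ, ∃ x ∈ 𝒜 d, x ∈ Q ∧ x ∉ P := by
  classical
  obtain ⟨x, hxQ, hxP⟩ := Set.not_subset.mp h
  by_contra! hcon
  apply hxP
  rw [← DirectSum.sum_support_decompose 𝒜 x]
  exact P.sum_mem fun i _ => hcon i _ (SetLike.coe_mem _) (hQ i hxQ)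

theorem exists_homogeneous_pos_notMem {P : Ideal A}
    (h : ¬ (HomogeneousIdeal.irrelevant 𝒜).toIdeal ≤ P) :
    ∃ d : ℕ, 0 < d ∧ ∃ x ∈ 𝒜 d, x ∉ P := by
  obtain ⟨d, x, hx, hxm, hxP⟩ :=
    exists_homogeneous_mem_notMem (HomogeneousIdeal.irrelevant 𝒜).isHomogeneous h
  refine ⟨d, Nat.pos_of_ne_zero ?_, x, hx, hxP⟩
  rintro rfl
  apply hxP
  rw [HomogeneousIdeal.mem_iff, HomogeneousIdeal.mem_irrelevant_iff, GradedRing.proj_apply,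
    DirectSum.decompose_of_mem_same 𝒜 hx] at hxm
  rw [hxm]
  exact P.zero_mem

/-- Homogeneous prime avoidance. -/
theorem exists_homogeneous_notMem_of_antichain (s : Finset (Ideal A))
    (hprime : ∀ P ∈ s, P.IsPrime) (hhom : ∀ P ∈ s, P.IsHomogeneous 𝒜)
    (hirr : ∀ P ∈ s, ¬ (HomogeneousIdeal.irrelevant 𝒜).toIdeal ≤ P)
    (hanti : ∀ P ∈ s, ∀ Q ∈ s, Q ≤ P → Q = P) :
    s.Nonempty → ∃ d : ℕ, 0 < d ∧ ∃ x ∈ 𝒜 d, ∀ P ∈ s, x ∉ P := by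
  classical
  induction s using Finset.induction_on with
  | empty => simp
  | insert P s hPs ih =>
    intro _
    have hP : P.IsPrime := hprime P (Finset.mem_insert_self _ _)
    obtain ⟨c, hc, y, hyc, hyP⟩ := exists_homogeneous_pos_notMem (hirr P (Finset.mem_insert_self _ _))
    rcases s.eq_empty_or_nonempty with rfl | hs
    · exact ⟨c, hc, y, hyc, by simpa using hyP⟩
    obtain ⟨a, ha, f, hfa, hf⟩ := ih (fun Q hQ => hprime Q (Finset.mem_insert_of_mem hQ))
      (fun Q hQ => hhom Q (Finset.mem_insert_of_mem hQ))
      (fun Q hQ => hirr Q (Finset.mem_insert_of_mem hQ))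
      (fun Q hQ Q' hQ' => hanti Q (Finset.mem_insert_of_mem hQ) Q' (Finset.mem_insert_of_mem hQ')) hs
    by_cases hfP : f ∈ P
    swap
    · refine ⟨a, ha, f, hfa, fun Q hQ => ?_⟩
      rcases Finset.mem_insert.mp hQ with rfl | hQ
      exacts [hfP, hf Q hQ]
    have hz : ∀ Q : Ideal A, ∃ d : ℕ, ∃ x ∈ 𝒜 d, Q ∈ s → x ∈ Q ∧ x ∉ P := by
      intro Q
      by_cases hQ : Q ∈ s
      · obtain ⟨d, x, hx, hx'⟩ := exists_homogeneous_mem_notMem (𝒜 := 𝒜) (P := P)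
          (hhom Q (Finset.mem_insert_of_mem hQ)) fun hle => hPs
            (hanti P (Finset.mem_insert_self _ _) Q (Finset.mem_insert_of_mem hQ) hle ▸ hQ)
        exact ⟨d, x, hx, fun _ => hx'⟩
      · exact ⟨0, 0, zero_mem _, fun h => absurd h hQ⟩
    choose d x hxd hx using hz
    -- `h` is homogeneous of positive degree, lies in every ideal of `s`, but not in `P`
    set h := y * ∏ Q ∈ s, x Q with hdef
    set b := c + ∑ Q ∈ s, d Q with hbdef
    have hhb : h ∈ 𝒜 b := SetLike.mul_mem_graded hyc
      (SetLike.prod_mem_graded 𝒜 (fun Q => d Q) (fun Q => x Q) fun Q _ => hxd Q)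
    have hhP : h ∉ P := by
      rw [hdef, hP.mul_mem_iff_mem_or_mem, hP.prod_mem_iff]
      rintro (h1 | ⟨Q, hQ, h1⟩)
      exacts [hyP h1, (hx Q hQ).2 h1]
    have hhs : ∀ Q ∈ s, h ∈ Q := fun Q hQ =>
      Q.mul_mem_left _ (Ideal.mem_of_dvd _ (Finset.dvd_prod_of_mem x hQ) (hx Q hQ).1)
    have hb : 0 < b := by omega
    -- the powers make the two summands homogeneous of the same degree
    refine ⟨b * a, by positivity, f ^ b + h ^ a, add_mem ?_ ?_, fun Q hQ => ?_⟩
    · have := SetLike.pow_mem_graded b hfa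
      rwa [smul_eq_mul] at this
    · have := SetLike.pow_mem_graded a hhb
      rwa [smul_eq_mul, mul_comm] at this
    · rcases Finset.mem_insert.mp hQ with rfl | hQs
      · intro hmem
        exact hhP (hP.mem_of_pow_mem a ((Ideal.add_mem_iff_right _
          (Ideal.pow_mem_of_mem _ hfP b hb)).mp hmem))
      · intro hmem
        exact hf Q hQs ((hprime Q hQ).mem_of_pow_mem b ((Ideal.add_mem_iff_left _
          (Ideal.pow_mem_of_mem _ (hhs Q hQs) a ha)).mp hmem))

theorem isHomogeneous_of_mem_minimalPrimes {I P : Ideal A} (hI : I.IsHomogeneous 𝒜)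
    (hP : P ∈ I.minimalPrimes) : P.IsHomogeneous 𝒜 := by
  have hcore : (P.homogeneousCore 𝒜).toIdeal.IsPrime := Ideal.IsPrime.homogeneousCore hP.1.1
  have hle : I ≤ (P.homogeneousCore 𝒜).toIdeal := by
    have : (I.homogeneousCore 𝒜).toIdeal ≤ (P.homogeneousCore 𝒜).toIdeal :=
      Ideal.homogeneousCore_mono 𝒜 hP.1.2
    rwa [hI.toIdeal_homogeneousCore_eq_self] at this
  have h1 := hP.2 ⟨hcore, hle⟩ (Ideal.toIdeal_homogeneousCore_le 𝒜 P)
  rw [le_antisymm h1 (Ideal.toIdeal_homogeneousCore_le 𝒜 P)]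
  exact HomogeneousIdeal.isHomogeneous _

/-- The partially ordered set of homogeneous primes containing `I`. -/
abbrev HomogeneousPrimesOver (𝒜 : ℕ → σ) [GradedRing 𝒜] (I : Ideal A) : Type _ :=
  {P : Ideal A // P.IsPrime ∧ P.IsHomogeneous 𝒜 ∧ I ≤ P}

/-- If the chains of homogeneous primes above the homogeneous ideal `I` have length at most `e`,
then `e` homogeneous elements of positive degree cut `V(I)` down to the vertex. -/
theorem exists_homogeneous_parameters [IsNoetherianRing A] (m : Ideal A)
    (hm : m = (HomogeneousIdeal.irrelevant 𝒜).toIdeal) (hmp : m.IsPrime)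
    (hmax : ∀ P : Ideal A, P.IsHomogeneous 𝒜 → P ≠ ⊤ → P ≤ m) (e : ℕ) :
    ∀ I : Ideal A, I.IsHomogeneous 𝒜 → Order.krullDim (HomogeneousPrimesOver 𝒜 I) ≤ e →
      ∃ T : Finset A, T.card ≤ e ∧ (∀ t ∈ T, ∃ d : ℕ, 0 < d ∧ t ∈ 𝒜 d) ∧
        m ≤ (I ⊔ Ideal.span T).radical := by
  classical
  have hmhom : m.IsHomogeneous 𝒜 := hm ▸ HomogeneousIdeal.isHomogeneous _
  induction e with
  | zero =>
    intro I hI hc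
    refine ⟨∅, le_rfl, by simp, ?_⟩
    rw [Finset.coe_empty, Ideal.span_empty, sup_bot_eq, ← Ideal.sInf_minimalPrimes]
    refine le_sInf fun P hP => ?_
    by_contra hle
    have hPhom := isHomogeneous_of_mem_minimalPrimes hI hP
    have hlt : P < m := lt_of_le_not_ge (hmax P hPhom hP.1.1.ne_top) hle
    let P' : HomogeneousPrimesOver 𝒜 I := ⟨P, hP.1.1, hPhom, hP.1.2⟩
    let m' : HomogeneousPrimesOver 𝒜 I := ⟨m, hmp, hmhom, hP.1.2.trans hlt.le⟩
    have h1 := (Order.LTSeries.length_le_krullDim ((RelSeries.singleton _ m').cons P' hlt)).trans hc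
    have h2 : (0 + 0 + 1 : ℕ) ≤ 0 := Nat.cast_le (α := WithBot ℕ∞).mp h1
    omega
  | succ e ih =>
    intro I hI hc
    -- a homogeneous `f` that avoids the minimal primes other than `m` shortens the chains above `I`
    let s := I.finite_minimalPrimes_of_isNoetherianRing.toFinset.filter fun P => ¬ m ≤ P
    have hs : ∀ P, P ∈ s ↔ P ∈ I.minimalPrimes ∧ ¬ m ≤ P := by
      intro P
      rw [Finset.mem_filter, Set.Finite.mem_toFinset]
    by_cases hne : s.Nonempty
    swap
    · refine ⟨∅, by simp, by simp, ?_⟩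
      rw [Finset.coe_empty, Ideal.span_empty, sup_bot_eq, ← Ideal.sInf_minimalPrimes]
      refine le_sInf fun P hP => ?_
      by_contra hle
      exact hne ⟨P, (hs P).mpr ⟨hP, hle⟩⟩
    obtain ⟨d, hd, f, hfd, hf⟩ := exists_homogeneous_notMem_of_antichain (𝒜 := 𝒜) s
      (fun P hP => ((hs P).mp hP).1.1.1)
      (fun P hP => isHomogeneous_of_mem_minimalPrimes hI ((hs P).mp hP).1)
      (fun P hP => hm ▸ ((hs P).mp hP).2)
      (fun P hP Q hQ hle => le_antisymm hle (((hs P).mp hP).1.2 ((hs Q).mp hQ).1.1 hle)) hne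
    have hI' : (I ⊔ Ideal.span {f}).IsHomogeneous 𝒜 := by
      refine hI.sup (Ideal.homogeneous_span 𝒜 _ ?_)
      rintro x rfl
      exact ⟨d, hfd⟩
    obtain ⟨T, hT, hTd, hrad⟩ := ih (I ⊔ Ideal.span {f}) hI' (by
      refine iSup_le fun c => ?_
      have hc0 := (c 0).2.1
      obtain ⟨P, hP, hPc⟩ := Ideal.exists_minimalPrimes_le
        (I := I) (J := (c 0).1) (le_sup_left.trans (c 0).2.2.2)
      by_cases hmP : m ≤ P
      · -- the chain starts at the vertex
        have h0 : c.length = 0 := by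
          by_contra h
          have h1 : c 0 < c (Fin.last _) := c.strictMono (Fin.pos_iff_ne_zero.mpr fun h2 => h (by
            simpa using congrArg Fin.val h2))
          have h2 : (c (Fin.last _)).1 ≤ m := hmax _ (c _).2.2.1 (c _).2.1.ne_top
          exact absurd (hmP.trans hPc) (not_le_of_gt (lt_of_lt_of_le h1 h2))
        rw [h0]
        exact_mod_cast zero_le
      · have hfP := hf P ((hs P).mpr ⟨hP, hmP⟩)
        let P' : HomogeneousPrimesOver 𝒜 I :=
          ⟨P, hP.1.1, isHomogeneous_of_mem_minimalPrimes hI hP, hP.1.2⟩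
        let ι : HomogeneousPrimesOver 𝒜 (I ⊔ Ideal.span {f}) → HomogeneousPrimesOver 𝒜 I :=
          fun Q => ⟨Q.1, Q.2.1, Q.2.2.1, le_sup_left.trans Q.2.2.2⟩
        let c' : LTSeries (HomogeneousPrimesOver 𝒜 I) := c.map ι fun _ _ h => h
        have hlt : P' < c'.head := lt_of_le_of_ne hPc fun h => hfP (by
          have h3 : f ∈ (c 0).1 := (c 0).2.2.2
            (le_sup_right (a := I) (Ideal.mem_span_singleton_self f))
          have h4 : P = (c 0).1 := congrArg Subtype.val h
          rwa [h4])
        have h1 := (Order.LTSeries.length_le_krullDim (c'.cons P' hlt)).trans hc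
        have h2 : c.length + 1 ≤ e + 1 := by
          have : (c'.cons P' hlt).length = c.length + 1 := by
            change 0 + c.length + 1 = _
            omega
          rw [this] at h1
          exact_mod_cast h1
        have h3 : c.length ≤ e := by omega
        exact_mod_cast h3)
    refine ⟨insert f T, (Finset.card_insert_le _ _).trans (by omega), ?_, ?_⟩
    · intro t ht
      rcases Finset.mem_insert.mp ht with rfl | ht
      exacts [⟨d, hd, hfd⟩, hTd t ht]
    · rwa [Finset.coe_insert, Ideal.span_insert, ← sup_assoc]

end HomogeneousParameters

section WeightedParameters

open MvPolynomial

attribute [local instance] MvPolynomial.weightedGradedAlgebra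

variable {ι : Type}

theorem decompose_eq_weightedHomogeneousComponent {M : Type*} [AddCommMonoid M] [DecidableEq M]
    {τ : Type*} (v : τ → M) (f : MvPolynomial τ ℂ) (d : M) :
    (DirectSum.decompose (weightedHomogeneousSubmodule ℂ v) f d : MvPolynomial τ ℂ) =
      weightedHomogeneousComponent v d f :=
  weightedDecomposition.decompose'_apply ℂ v f d

theorem weight_eq_zero_iff {w : ι → ℕ} (hw : ∀ i, 0 < w i) (q : ι →₀ ℕ) :
    Finsupp.weight w q = 0 ↔ q = 0 := by
  constructor
  · intro h
    ext i
    by_contra hi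
    have := Finsupp.le_weight_of_ne_zero' w (s := i) (f := q) hi
    have h2 := hw i
    omega
  · rintro rfl
    simp

/-- For positive weights the irrelevant ideal is the ideal of polynomials without constant term. -/
theorem ker_constantCoeff_eq_irrelevant {w : ι → ℕ} (hw : ∀ i, 0 < w i) :
    RingHom.ker (constantCoeff (σ := ι) (R := ℂ)) =
      (HomogeneousIdeal.irrelevant (weightedHomogeneousSubmodule ℂ w)).toIdeal := by
  ext f
  rw [RingHom.mem_ker, HomogeneousIdeal.mem_iff, HomogeneousIdeal.mem_irrelevant_iff,
    GradedRing.proj_apply, decompose_eq_weightedHomogeneousComponent]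
  constructor
  · intro h
    ext q
    rw [coeff_weightedHomogeneousComponent, coeff_zero]
    split_ifs with hq
    · rw [weight_eq_zero_iff hw] at hq
      rw [hq]
      exact h
    · rfl
  · intro h
    have := congrArg (coeff 0) h
    rwa [coeff_weightedHomogeneousComponent, if_pos (by simp), coeff_zero] at this

theorem le_ker_constantCoeff_of_isHomogeneous {w : ι → ℕ} (hw : ∀ i, 0 < w i)
    {P : Ideal (MvPolynomial ι ℂ)} (hP : P.IsHomogeneous (weightedHomogeneousSubmodule ℂ w))
    (hne : P ≠ ⊤) : P ≤ RingHom.ker (constantCoeff (σ := ι) (R := ℂ)) := by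
  intro f hf
  rw [RingHom.mem_ker]
  by_contra hc
  apply hne
  have h := hP 0 hf
  rw [decompose_eq_weightedHomogeneousComponent] at h
  have h2 : weightedHomogeneousComponent w 0 f = C (constantCoeff f) := by
    classical
    ext q
    rw [coeff_weightedHomogeneousComponent, coeff_C]
    simp only [weight_eq_zero_iff hw, eq_comm (a := (0 : ι →₀ ℕ))]
    split_ifs with hq
    · rw [hq]; rfl
    · rfl
  rw [h2] at h
  exact P.eq_top_of_isUnit_mem h ((IsUnit.mk0 _ hc).map C)

/-- Graded Nakayama: if the homogeneous elements of `T` cut `V(I)` down to the vertex, then modulo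
`I` every variable is integral over the algebra generated by `T`. -/
theorem isIntegral_of_le_radical [Fintype ι] {w : ι → ℕ} {I : Ideal (MvPolynomial ι ℂ)}
    (hI : I.IsHomogeneous (weightedHomogeneousSubmodule ℂ w)) (T : Finset (MvPolynomial ι ℂ))
    (hT : ∀ t ∈ T, ∃ d : ℕ, 0 < d ∧ t ∈ weightedHomogeneousSubmodule ℂ w d)
    (hrad : ∀ i, X i ∈ (I ⊔ Ideal.span T).radical) {K : Type*} [Field K] [Algebra ℂ K]
    (ev : MvPolynomial ι ℂ →ₐ[ℂ] K) (hev : ∀ f ∈ I, ev f = 0) (i : ι) :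
    IsIntegral (Algebra.adjoin ℂ (ev '' T)) (ev (X i)) := by
  classical
  choose M hM using hrad
  have hcut : ∀ q : ι →₀ ℕ, (∃ i, M i ≤ q i) → monomial q (1 : ℂ) ∈ I ⊔ Ideal.span T := by
    rintro q ⟨i, hi⟩
    have h1 : q = (q - Finsupp.single i (M i)) + Finsupp.single i (M i) :=
      (tsub_add_cancel_of_le (Finsupp.single_le_iff.mpr hi)).symm
    rw [h1, ← mul_one (1 : ℂ), ← monomial_mul]
    refine Ideal.mul_mem_left _ _ ?_
    rw [← X_pow_eq_monomial]
    exact hM i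
  have hfin : {q : ι →₀ ℕ | ∀ i, q i < M i}.Finite := by
    refine (Set.finite_Iic (Finsupp.equivFunOnFinite.symm M)).subset fun q hq i => ?_
    exact (hq i).le
  set S := Algebra.adjoin ℂ (ev '' T) with hS
  let N : Submodule S K :=
    Submodule.span S ((fun q => ev (monomial q 1)) '' {q : ι →₀ ℕ | ∀ i, q i < M i})
  have hsmul : ∀ (c : ℂ) (x : K), x ∈ N → algebraMap ℂ K c * x ∈ N := by
    intro c x hx
    have := N.smul_mem (algebraMap ℂ S c) hx
    rwa [Algebra.smul_def, ← IsScalarTower.algebraMap_apply] at this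
  have hpoly : ∀ (f : MvPolynomial ι ℂ), (∀ q ∈ f.support, ev (monomial q 1) ∈ N) → ev f ∈ N := by
    intro f hf
    rw [f.as_sum, map_sum]
    refine N.sum_mem fun q hq => ?_
    have : monomial q (coeff q f) = C (coeff q f) * monomial q 1 := by
      rw [C_mul_monomial, mul_one]
    rw [this, map_mul, ← algebraMap_eq, AlgHom.commutes]
    exact hsmul _ _ (hf q hq)
  -- a monomial outside the box is congruent modulo `I` to a combination of the elements of `T`,
  -- whose coefficients have smaller degree
  have hmon : ∀ d : ℕ, ∀ q : ι →₀ ℕ, Finsupp.weight w q = d → ev (monomial q 1) ∈ N := by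
    intro d
    induction d using Nat.strong_induction_on with
    | _ d ih =>
      intro q hq
      by_cases hlt : ∀ i, q i < M i
      · exact Submodule.subset_span ⟨q, hlt, rfl⟩
      push Not at hlt
      obtain ⟨b, hb, c, hc, hbc⟩ := Submodule.mem_sup.mp (hcut q hlt)
      obtain ⟨a, -, ha⟩ := Submodule.mem_span_finset.mp hc
      have h1 : monomial q (1 : ℂ) = weightedHomogeneousComponent w d (monomial q 1) := by
        rw [weightedHomogeneousComponent_of_mem
          (isWeightedHomogeneous_monomial w q (1 : ℂ) hq), if_pos rfl]
      rw [h1, ← hbc, map_add, map_add, ← ha, map_sum, map_sum,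
        hev _ (by rw [← decompose_eq_weightedHomogeneousComponent]; exact hI d hb), zero_add]
      refine N.sum_mem fun t ht => ?_
      obtain ⟨e, he, hte⟩ := hT t ht
      rw [← decompose_eq_weightedHomogeneousComponent, smul_eq_mul]
      by_cases hed : e ≤ d
      · rw [DirectSum.coe_decompose_mul_of_right_mem_of_le _ hte hed,
          decompose_eq_weightedHomogeneousComponent, map_mul, mul_comm]
        have h2 : ev (weightedHomogeneousComponent w (d - e) (a t)) ∈ N := by
          refine hpoly _ fun q' hq' => ih (d - e) (by omega) q' ?_
          exact weightedHomogeneousComponent_isWeightedHomogeneous (d - e) (a t)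
            (mem_support_iff.mp hq')
        exact N.smul_mem ⟨ev t, Algebra.subset_adjoin ⟨t, ht, rfl⟩⟩ h2
      · rw [DirectSum.coe_decompose_mul_of_right_mem_of_not_le _ hte hed, map_zero]
        exact N.zero_mem
  have hall : ∀ f, ev f ∈ N := fun f => hpoly f fun q _ => hmon _ q rfl
  refine isIntegral_of_smul_mem_submodule N ?_ (Submodule.fg_span (hfin.image _)) _ ?_
  · intro h
    have := hall 1
    rw [h, map_one, Submodule.mem_bot] at this
    exact one_ne_zero this
  · intro x hx
    induction hx using Submodule.span_induction with
    | mem x hx =>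
      obtain ⟨q, -, rfl⟩ := hx
      rw [smul_eq_mul, ← map_mul]
      exact hall _
    | zero => rw [smul_zero]; exact N.zero_mem
    | add x y _ _ hx hy => rw [smul_add]; exact N.add_mem hx hy
    | smul s x _ hx => rw [smul_comm]; exact N.smul_mem s hx

theorem exists_parameters_isIntegral [Fintype ι] {w : ι → ℕ} (hw : ∀ i, 0 < w i)
    {I : Ideal (MvPolynomial ι ℂ)} (hI : I.IsHomogeneous (weightedHomogeneousSubmodule ℂ w))
    {e : ℕ}
    (he : Order.krullDim (HomogeneousPrimesOver (weightedHomogeneousSubmodule ℂ w) I) ≤ e) :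
    ∃ T : Finset (MvPolynomial ι ℂ), T.card ≤ e ∧
      ∀ {K : Type} [Field K] [Algebra ℂ K] (ev : MvPolynomial ι ℂ →ₐ[ℂ] K),
        (∀ f ∈ I, ev f = 0) → ∀ i, IsIntegral (Algebra.adjoin ℂ (ev '' T)) (ev (X i)) := by
  obtain ⟨T, hTe, hT, hrad⟩ := exists_homogeneous_parameters _
    (ker_constantCoeff_eq_irrelevant hw) (RingHom.ker_isPrime _)
    (fun P hP hne => le_ker_constantCoeff_of_isHomogeneous hw hP hne) e I hI he
  exact ⟨T, hTe, fun ev hev i => isIntegral_of_le_radical hI T hT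
    (fun j => hrad (by simp [RingHom.mem_ker])) ev hev i⟩

end WeightedParameters

/-! ### Germs and weighted homogeneous primes -/

section WeightedGerms

open MvPolynomial

attribute [local instance] MvPolynomial.weightedGradedAlgebra

theorem isConvergent_coe {n : ℕ} (f : MvPolynomial (Fin n) ℂ) :
    IsConvergent (f : MvPowerSeries (Fin n) ℂ) := by
  refine ⟨1, one_pos, summable_of_ne_finset_zero (s := f.support) fun q hq => ?_⟩
  rw [MvPolynomial.coeff_coe, notMem_support_iff.mp hq]
  simp

/-- A polynomial as a germ. -/
def polyGerm (n : ℕ) : MvPolynomial (Fin n) ℂ →ₐ[ℂ] HoloGerm n :=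
  AlgHom.codRestrict (coeToMvPowerSeries.algHom ℂ) (HoloGerm n) fun f => by
    have : coeToMvPowerSeries.algHom ℂ f = (f : MvPowerSeries (Fin n) ℂ) := by
      rw [coeToMvPowerSeries.algHom_apply]
      simp
    rw [this]
    exact isConvergent_coe f

theorem germCoeff_polyGerm {n : ℕ} (q : Fin n →₀ ℕ) (f : MvPolynomial (Fin n) ℂ) :
    germCoeff q (polyGerm n f) = coeff q f := by
  change MvPowerSeries.coeff q (coeToMvPowerSeries.algHom ℂ f) = _
  rw [coeToMvPowerSeries.algHom_apply]
  simp

theorem germ_ext {n : ℕ} {f g : HoloGerm n} (h : ∀ q, germCoeff q f = germCoeff q g) : f = g :=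
  Subtype.ext (MvPowerSeries.ext h)

theorem germCoeff_add {n : ℕ} (q : Fin n →₀ ℕ) (f g : HoloGerm n) :
    germCoeff q (f + g) = germCoeff q f + germCoeff q g := by
  simp [germCoeff]

theorem germCoeff_sub {n : ℕ} (q : Fin n →₀ ℕ) (f g : HoloGerm n) :
    germCoeff q (f - g) = germCoeff q f - germCoeff q g := by
  simp [germCoeff]

theorem germCoeff_zero {n : ℕ} (q : Fin n →₀ ℕ) : germCoeff q (0 : HoloGerm n) = 0 := by
  simp [germCoeff]

theorem germCoeff_smul {n : ℕ} (q : Fin n →₀ ℕ) (c : ℂ) (f : HoloGerm n) :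
    germCoeff q (c • f) = c * germCoeff q f := by
  simp [germCoeff]

theorem germCoeff_mul {n : ℕ} (q : Fin n →₀ ℕ) (f g : HoloGerm n) :
    germCoeff q (f * g) =
      ∑ x ∈ Finset.HasAntidiagonal.antidiagonal q, germCoeff x.1 f * germCoeff x.2 g := by
  classical
  simp only [germCoeff, MulMemClass.coe_mul]
  rw [MvPowerSeries.coeff_mul]

theorem germCoeff_monomialGerm {n : ℕ} [DecidableEq (Fin n →₀ ℕ)] (q q' : Fin n →₀ ℕ) :
    germCoeff q (monomialGerm q') = if q = q' then 1 else 0 := by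
  classical
  simp only [germCoeff, monomialGerm]
  rw [MvPowerSeries.coeff_monomial]
  congr

theorem finite_weight_le {ι : Type} [Finite ι] {w : ι → ℕ} (hw : ∀ i, 0 < w i) (d : ℕ) :
    {q : ι →₀ ℕ | Finsupp.weight w q ≤ d}.Finite := by
  classical
  have := Fintype.ofFinite ι
  refine (Set.finite_Iic (Finsupp.equivFunOnFinite.symm fun _ : ι => d)).subset fun q hq i => ?_
  have h1 : w i * q i ≤ Finsupp.weight w q := by
    rw [Finsupp.weight_apply, Finsupp.sum]
    by_cases hi : i ∈ q.support
    · calc w i * q i = q i • w i := by rw [smul_eq_mul, mul_comm]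
        _ ≤ _ := Finset.single_le_sum (f := fun i => q i • w i) (fun _ _ => Nat.zero_le _) hi
    · rw [Finsupp.notMem_support_iff.mp hi]
      simp
  have h2 := hw i
  have h3 : Finsupp.weight w q ≤ d := hq
  change q i ≤ d
  nlinarith

theorem finite_weight_eq {ι : Type} [Finite ι] {w : ι → ℕ} (hw : ∀ i, 0 < w i) (d : ℕ) :
    {q : ι →₀ ℕ | Finsupp.weight w q = d}.Finite :=
  (finite_weight_le hw d).subset fun _ h => le_of_eq h

variable {n : ℕ} {w : Fin n → ℕ} (hw : ∀ i, 0 < w i)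

/-- The weighted homogeneous component of degree `d` of a germ; it is a polynomial because the
weights are positive. -/
def germComponent (d : ℕ) (f : HoloGerm n) : MvPolynomial (Fin n) ℂ :=
  ∑ q ∈ (finite_weight_eq hw d).toFinset, monomial q (germCoeff q f)

theorem coeff_germComponent (d : ℕ) (f : HoloGerm n) (q : Fin n →₀ ℕ) :
    coeff q (germComponent hw d f) = if Finsupp.weight w q = d then germCoeff q f else 0 := by
  classical
  rw [germComponent, coeff_sum]
  simp only [coeff_monomial]
  rw [Finset.sum_ite_eq']
  simp

theorem germComponent_add (d : ℕ) (f g : HoloGerm n) :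
    germComponent hw d (f + g) = germComponent hw d f + germComponent hw d g := by
  ext q
  simp only [coeff_add, coeff_germComponent, germCoeff_add]
  split_ifs <;> simp

theorem germComponent_mul (d : ℕ) (f g : HoloGerm n) :
    germComponent hw d (f * g) =
      ∑ x ∈ Finset.HasAntidiagonal.antidiagonal d,
        germComponent hw x.1 f * germComponent hw x.2 g := by
  classical
  ext q
  rw [coeff_germComponent, coeff_sum]
  simp only [coeff_mul, coeff_germComponent, germCoeff_mul]
  rw [Finset.sum_comm]
  have hwt : ∀ y ∈ Finset.HasAntidiagonal.antidiagonal q,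
      Finsupp.weight w y.1 + Finsupp.weight w y.2 = Finsupp.weight w q := fun y hy => by
    rw [← map_add, Finset.HasAntidiagonal.mem_antidiagonal.mp hy]
  split_ifs with hq
  · refine Finset.sum_congr rfl fun y hy => ?_
    rw [Finset.sum_eq_single (Finsupp.weight w y.1, Finsupp.weight w y.2)]
    · simp
    · intro x _ hx
      by_cases h1 : Finsupp.weight w y.1 = x.1
      · rw [if_neg fun h2 : Finsupp.weight w y.2 = x.2 => hx (Prod.ext h1.symm h2.symm), mul_zero]
      · rw [if_neg h1, zero_mul]
    · intro h
      exact absurd (Finset.HasAntidiagonal.mem_antidiagonal.mpr ((hwt y hy).trans hq)) h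
  · refine (Finset.sum_eq_zero fun y hy => Finset.sum_eq_zero fun x hx => ?_).symm
    have hx' := Finset.HasAntidiagonal.mem_antidiagonal.mp hx
    have hy' := hwt y hy
    by_cases h1 : Finsupp.weight w y.1 = x.1
    · rw [if_neg (by omega : ¬ Finsupp.weight w y.2 = x.2), mul_zero]
    · rw [if_neg h1, zero_mul]

theorem germComponent_polyGerm (d : ℕ) (f : MvPolynomial (Fin n) ℂ) :
    germComponent hw d (polyGerm n f) = weightedHomogeneousComponent w d f := by
  ext q
  rw [coeff_germComponent, coeff_weightedHomogeneousComponent, germCoeff_polyGerm]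

/-- The germs all of whose weighted homogeneous components lie in the ideal `P`. -/
def germIdeal (P : Ideal (MvPolynomial (Fin n) ℂ)) : Ideal (HoloGerm n) where
  carrier := {f | ∀ d, germComponent hw d f ∈ P}
  add_mem' hf hg d := by
    rw [germComponent_add]
    exact P.add_mem (hf d) (hg d)
  zero_mem' d := by
    have : germComponent hw d 0 = 0 := by
      ext q
      simp [coeff_germComponent, germCoeff_zero]
    rw [this]
    exact P.zero_mem
  smul_mem' c f hf d := by
    rw [smul_eq_mul, germComponent_mul]
    exact P.sum_mem fun x _ => P.mul_mem_left _ (hf x.2)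

theorem mem_germIdeal {P : Ideal (MvPolynomial (Fin n) ℂ)} {f : HoloGerm n} :
    f ∈ germIdeal hw P ↔ ∀ d, germComponent hw d f ∈ P := Iff.rfl

theorem polyGerm_mem_germIdeal {P : Ideal (MvPolynomial (Fin n) ℂ)}
    (hP : P.IsHomogeneous (weightedHomogeneousSubmodule ℂ w)) (f : MvPolynomial (Fin n) ℂ) :
    polyGerm n f ∈ germIdeal hw P ↔ f ∈ P := by
  simp only [mem_germIdeal, germComponent_polyGerm]
  exact (mem_iff_weightedHomogeneousComponent_mem ℂ w hP f).symm

/-- A weighted homogeneous prime stays prime in the ring of germs: multiply the lowest components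
that do not lie in it. -/
theorem germIdeal_isPrime {P : Ideal (MvPolynomial (Fin n) ℂ)} (hPp : P.IsPrime)
    (hP : P.IsHomogeneous (weightedHomogeneousSubmodule ℂ w)) : (germIdeal hw P).IsPrime := by
  classical
  refine Ideal.isPrime_iff.mpr ⟨fun h => hPp.ne_top ?_, fun {f g} hfg => ?_⟩
  · rw [Ideal.eq_top_iff_one] at h ⊢
    rw [← polyGerm_mem_germIdeal hw hP, map_one]
    exact h
  · by_contra! hcon
    simp only [mem_germIdeal, not_forall] at hcon
    obtain ⟨hf, hg⟩ := hcon
    set a := Nat.find hf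
    set b := Nat.find hg
    have ha : germComponent hw a f ∉ P := Nat.find_spec hf
    have hb : germComponent hw b g ∉ P := Nat.find_spec hg
    have h := hfg (a + b)
    rw [germComponent_mul, ← Finset.add_sum_erase _ _
      (Finset.HasAntidiagonal.mem_antidiagonal.mpr (rfl : (a, b).1 + (a, b).2 = a + b))] at h
    have hrest : ∑ x ∈ (Finset.HasAntidiagonal.antidiagonal (a + b)).erase (a, b),
        germComponent hw x.1 f * germComponent hw x.2 g ∈ P := by
      refine P.sum_mem fun x hx => ?_
      obtain ⟨hne, hx⟩ := Finset.mem_erase.mp hx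
      rw [Finset.HasAntidiagonal.mem_antidiagonal] at hx
      rcases lt_trichotomy x.1 a with hlt | heq | hgt
      · exact P.mul_mem_right _ (not_not.mp (Nat.find_min hf hlt))
      · exact absurd (Prod.ext heq (by simp only; omega)) hne
      · exact P.mul_mem_left _ (not_not.mp (Nat.find_min hg (show x.2 < b by omega)))
    rcases hPp.mem_or_mem ((Ideal.add_mem_iff_left _ hrest).mp h) with h | h
    exacts [ha h, hb h]

/-- The Krull dimension of a germ defined by weighted homogeneous polynomials bounds the chains of
weighted homogeneous primes containing them. -/
theorem krullDim_homogeneousPrimesOver_le {κ : Type*} (f : κ → HoloGerm n) (d : κ → ℕ)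
    (hf : ∀ i, ∀ q ∈ supp (f i), Finsupp.weight w q = d i) :
    Order.krullDim (HomogeneousPrimesOver (weightedHomogeneousSubmodule ℂ w)
      (Ideal.span (Set.range fun i => germComponent hw (d i) (f i)))) ≤
      ringKrullDim (HoloGerm n ⧸ Ideal.span (Set.range f)) := by
  rw [ringKrullDim_quotient]
  refine Order.krullDim_le_of_strictMono (fun P => ⟨⟨germIdeal hw P.1,
    germIdeal_isPrime hw P.2.1 P.2.2.1⟩, ?_⟩) fun P Q hPQ => ?_
  · rw [PrimeSpectrum.mem_zeroLocus, SetLike.coe_subset_coe, Ideal.span_le]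
    rintro _ ⟨i, rfl⟩
    intro e
    by_cases he : e = d i
    · rw [he]
      exact P.2.2.2 (Ideal.subset_span ⟨i, rfl⟩)
    · have : germComponent hw e (f i) = 0 := by
        ext q
        rw [coeff_germComponent, coeff_zero]
        split_ifs with hq
        · by_contra h
          exact he (hq ▸ hf i q h)
        · rfl
      rw [this]
      exact P.1.zero_mem
  · change germIdeal hw P.1 < germIdeal hw Q.1
    refine lt_of_le_of_ne (fun f hf d => hPQ.le (hf d)) fun heq => ?_
    apply hPQ.not_ge
    intro f hf
    change f ∈ P.1
    rw [← polyGerm_mem_germIdeal hw P.2.2.1, heq, polyGerm_mem_germIdeal hw Q.2.2.1]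
    exact hf

theorem isHomogeneous_span_germComponent {κ : Type*} (f : κ → HoloGerm n) (d : κ → ℕ) :
    (Ideal.span (Set.range fun i => germComponent hw (d i) (f i))).IsHomogeneous
      (weightedHomogeneousSubmodule ℂ w) := by
  refine Ideal.homogeneous_span _ _ ?_
  rintro _ ⟨i, rfl⟩
  refine ⟨d i, fun q hq => ?_⟩
  rw [coeff_germComponent] at hq
  by_contra h
  exact hq (if_neg h)

/-- If weighted homogeneous germs without constant term define a germ of codimension at least `c`,
then modulo these germs all coordinates are integral over `n - c` polynomials. -/
theorem exists_parameters_of_codimAtLeast {κ : Type*} (f : κ → HoloGerm n) (d : κ → ℕ)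
    (hf : ∀ i, ∀ q ∈ supp (f i), Finsupp.weight w q = d i) (hf0 : ∀ i, germCoeff 0 (f i) = 0)
    {c : ℤ} (hc : CodimAtLeast (Ideal.span (Set.range f)) c) :
    ∃ T : Finset (MvPolynomial (Fin n) ℂ), (T.card : ℤ) ≤ n - c ∧
      ∀ {K : Type} [Field K] [Algebra ℂ K] (ev : MvPolynomial (Fin n) ℂ →ₐ[ℂ] K),
        (∀ i, ev (germComponent hw (d i) (f i)) = 0) →
          ∀ i, IsIntegral (Algebra.adjoin ℂ (ev '' T)) (ev (X i)) := by
  set I := Ideal.span (Set.range fun i => germComponent hw (d i) (f i)) with hIdef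
  have hI := isHomogeneous_span_germComponent hw f d
  have hIm : I ≤ RingHom.ker (constantCoeff (σ := Fin n) (R := ℂ)) := by
    rw [hIdef, Ideal.span_le]
    rintro _ ⟨i, rfl⟩
    rw [SetLike.mem_coe, RingHom.mem_ker, constantCoeff_eq]
    simp only [coeff_germComponent, hf0, ite_self]
  have hne : Nonempty (HomogeneousPrimesOver (weightedHomogeneousSubmodule ℂ w) I) :=
    ⟨⟨_, RingHom.ker_isPrime (constantCoeff (σ := Fin n) (R := ℂ)),
      ker_constantCoeff_eq_irrelevant hw ▸ HomogeneousIdeal.isHomogeneous _, hIm⟩⟩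
  have hle := krullDim_homogeneousPrimesOver_le hw f d hf
  set D := Order.krullDim (HomogeneousPrimesOver (weightedHomogeneousSubmodule ℂ w) I) with hD
  obtain ⟨e, he⟩ := WithBot.ne_bot_iff_exists.mp
    (Order.krullDim_ne_bot_iff.mpr hne : D ≠ ⊥)
  have htop : e ≠ ⊤ := by
    rintro rfl
    have h1 := hc ((n - c).toNat + 1) (by
      refine le_trans ?_ (he.le.trans hle)
      exact WithBot.coe_le_coe.mpr le_top)
    omega
  obtain ⟨e, rfl⟩ := ENat.ne_top_iff_exists.mp htop
  have he' : D = (e : WithBot ℕ∞) := he.symm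
  obtain ⟨T, hT, hint⟩ := exists_parameters_isIntegral hw hI (e := e) he'.le
  have h1 := hc e (he' ▸ hle)
  refine ⟨T, by omega, fun ev hev i => hint ev (fun f hf => ?_) i⟩
  have : I ≤ RingHom.ker ev.toRingHom := by
    rw [hIdef, Ideal.span_le]
    rintro _ ⟨i, rfl⟩
    exact hev i
  exact this hf

end WeightedGerms

/-! ### The filtration by monomial ideals -/

section AmbientFiltration

variable {n r : ℕ} (p : Fin r → Fin n → ℕ)

/-- The vector `(⟨p₁, q⟩, …, ⟨p_r, q⟩)`. -/
def pairings (q : Fin n →₀ ℕ) : Fin r → ℤ := fun j => pairing (p j) q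

theorem pairing_eq_weight (w : Fin n → ℕ) (q : Fin n →₀ ℕ) : pairing w q = Finsupp.weight w q := by
  rw [Finsupp.weight_apply, Finsupp.sum_fintype _ _ (by simp), pairing]
  simp [mul_comm]

theorem pairings_add (a b : Fin n →₀ ℕ) : pairings p (a + b) = pairings p a + pairings p b := by
  ext j
  simp [pairings, pairing_eq_weight]

theorem pairings_zero : pairings p (0 : Fin n →₀ ℕ) = 0 := by
  ext j
  simp [pairings, pairing_eq_weight]

theorem pairings_nonneg (q : Fin n →₀ ℕ) : 0 ≤ pairings p q := fun _ => Int.natCast_nonneg _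

theorem pairings_mono {a b : Fin n →₀ ℕ} (h : a ≤ b) : pairings p a ≤ pairings p b := by
  rw [← tsub_add_cancel_of_le h, pairings_add]
  exact le_add_of_nonneg_left (pairings_nonneg p _)

/-- The germs that contain only monomials `z^q` with `⟨p_j, q⟩ ≥ μ_j` for all `j`. -/
def supportFiltration (μ : Fin r → ℤ) : Ideal (HoloGerm n) where
  carrier := {f | ∀ q, germCoeff q f ≠ 0 → μ ≤ pairings p q}
  add_mem' {f g} hf hg q hq := by
    rw [germCoeff_add] at hq
    by_cases h : germCoeff q f = 0
    · exact hg q fun h' => hq (by rw [h, h', add_zero])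
    · exact hf q h
  zero_mem' q hq := absurd (germCoeff_zero q) hq
  smul_mem' c f hf q hq := by
    rw [smul_eq_mul, germCoeff_mul] at hq
    obtain ⟨x, hx, hne⟩ := Finset.exists_ne_zero_of_sum_ne_zero hq
    refine (hf x.2 (right_ne_zero_of_mul hne)).trans (pairings_mono p ?_)
    rw [← Finset.HasAntidiagonal.mem_antidiagonal.mp hx]
    exact le_add_self

theorem IsConvergent.shift {f : MvPowerSeries (Fin n) ℂ} (hf : IsConvergent f) (b : Fin n →₀ ℕ) :
    IsConvergent (fun q => MvPowerSeries.coeff (q + b) f : MvPowerSeries (Fin n) ℂ) := by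
  obtain ⟨R, hR, hs⟩ := hf
  refine ⟨R, hR, ?_⟩
  have h1 := (hs.comp_injective (add_left_injective b)).mul_right (R ^ b.degree)⁻¹
  refine h1.congr fun q => ?_
  have h2 : R ^ b.degree ≠ 0 := by positivity
  simp only [Function.comp_apply, map_add, pow_add]
  rw [mul_assoc, mul_assoc, mul_inv_cancel₀ h2, mul_one]
  rfl

open Classical in
/-- The part of `f / z^b` that comes from the monomials `z^q` of `f` with `min(q, M) = b`. -/
def shiftPart (M : ℕ) (b : Fin n →₀ ℕ) (f : HoloGerm n) : HoloGerm n :=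
  ⟨fun q => if (q + b) ⊓ Finsupp.equivFunOnFinite.symm (fun _ => M) = b
      then germCoeff (q + b) f else 0,
    IsConvergent.mono (f.2.shift b) fun q => by
      change ‖if _ then _ else _‖ ≤ ‖MvPowerSeries.coeff (q + b) _‖
      split_ifs
      · exact le_refl _
      · simp⟩

open Classical in
theorem germCoeff_shiftPart (M : ℕ) (b q : Fin n →₀ ℕ) (f : HoloGerm n) :
    germCoeff q (shiftPart M b f) =
      if (q + b) ⊓ Finsupp.equivFunOnFinite.symm (fun _ => M) = b
        then germCoeff (q + b) f else 0 := rfl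

theorem germCoeff_monomialGerm_mul [DecidableEq (Fin n →₀ ℕ)] (b q : Fin n →₀ ℕ) (f : HoloGerm n)
    [Decidable (b ≤ q)] :
    germCoeff q (monomialGerm b * f) = if b ≤ q then germCoeff (q - b) f else 0 := by
  classical
  simp only [germCoeff, MulMemClass.coe_mul, monomialGerm]
  rw [MvPowerSeries.coeff_monomial_mul]
  simp

/-- Truncating the exponents of `z^q` at a large bound `M` does not leave the filtration, so the
ideal `F_μ` is generated by the monomials in a box, and it consists of all germs with the right
support. -/
theorem ambientFiltration_eq (hp : ∀ j l, 0 < p j l) (μ : Fin r → ℤ) :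
    ambientFiltration p μ = supportFiltration p μ := by
  classical
  apply le_antisymm
  · rw [ambientFiltration, Ideal.span_le]
    rintro _ ⟨q, hq, rfl⟩ q' hq'
    rw [germCoeff_monomialGerm] at hq'
    rw [show q' = q by by_contra h; exact hq' (if_neg h)]
    exact hq
  · intro f hf
    set M : ℕ := ∑ j, (μ j).toNat with hM
    have hMμ : ∀ j, μ j ≤ M := fun j => by
      have := Finset.single_le_sum (f := fun j => (μ j).toNat) (fun _ _ => Nat.zero_le _)
        (Finset.mem_univ j)
      have h2 := Int.self_le_toNat (μ j)
      omega
    set m : Fin n →₀ ℕ := Finsupp.equivFunOnFinite.symm (fun _ => M) with hm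
    have hmin : ∀ q, μ ≤ pairings p q → μ ≤ pairings p (q ⊓ m) := by
      intro q hq
      by_cases h : q ≤ m
      · rwa [inf_eq_left.mpr h]
      · obtain ⟨l, hl⟩ : ∃ l, M < q l := by
          by_contra! hcon
          exact h fun l => hcon l
        intro j
        refine (hMμ j).trans ?_
        have h1 : M ≤ pairing (p j) (q ⊓ m) := by
          rw [pairing]
          calc M ≤ p j l * (q ⊓ m) l := by
                have h2 : (q ⊓ m) l = M := by
                  rw [Finsupp.inf_apply]
                  exact inf_eq_right.mpr hl.le
                rw [h2]
                exact Nat.le_mul_of_pos_left _ (hp j l)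
            _ ≤ _ := Finset.single_le_sum (f := fun i => p j i * (q ⊓ m) i)
                (fun _ _ => Nat.zero_le _) (Finset.mem_univ l)
        exact Int.ofNat_le.mpr h1
    have hfin : {b : Fin n →₀ ℕ | μ ≤ pairings p b ∧ b ≤ m}.Finite :=
      (Set.finite_Iic m).subset fun b hb => hb.2
    -- the monomials `z^q` of `f` are grouped by `b = min(q, m)`, and `z^b` is factored out
    have key : f = ∑ b ∈ hfin.toFinset, monomialGerm b * shiftPart M b f := by
      refine germ_ext fun q => ?_
      have hsum : ∀ s : Finset (Fin n →₀ ℕ), germCoeff q (∑ b ∈ s, monomialGerm b * shiftPart M b f)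
          = ∑ b ∈ s, germCoeff q (monomialGerm b * shiftPart M b f) := by
        intro s
        induction s using Finset.induction_on with
        | empty => exact germCoeff_zero q
        | insert a s ha ih => rw [Finset.sum_insert ha, Finset.sum_insert ha, germCoeff_add, ih]
      have hterm : ∀ b, germCoeff q (monomialGerm b * shiftPart M b f) =
          if q ⊓ m = b then germCoeff q f else 0 := by
        intro b
        rw [germCoeff_monomialGerm_mul, germCoeff_shiftPart]
        by_cases hb : b ≤ q
        · rw [if_pos hb, tsub_add_cancel_of_le hb]
        · rw [if_neg hb, if_neg]
          rintro rfl
          exact hb inf_le_left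
      rw [hsum, Finset.sum_congr rfl fun b _ => hterm b, Finset.sum_ite_eq]
      split_ifs with h
      · rfl
      · by_contra hne
        exact h (hfin.mem_toFinset.mpr ⟨hmin q (hf q hne), inf_le_right⟩)
    rw [key]
    refine Ideal.sum_mem _ fun b hb => Ideal.mul_mem_right _ _ (Ideal.subset_span ⟨b, ?_, rfl⟩)
    exact (hfin.mem_toFinset.mp hb).1

theorem mul_mem_supportFiltration {μ ν : Fin r → ℤ} {f g : HoloGerm n}
    (hf : f ∈ supportFiltration p μ) (hg : g ∈ supportFiltration p ν) :
    f * g ∈ supportFiltration p (μ + ν) := by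
  intro q hq
  rw [germCoeff_mul] at hq
  obtain ⟨x, hx, hne⟩ := Finset.exists_ne_zero_of_sum_ne_zero hq
  rw [← Finset.HasAntidiagonal.mem_antidiagonal.mp hx, pairings_add]
  exact add_le_add (hf x.1 (left_ne_zero_of_mul hne)) (hg x.2 (right_ne_zero_of_mul hne))

theorem supportFiltration_antitone : Antitone (supportFiltration (n := n) p) :=
  fun _ _ h _ hf q hq => h.trans (hf q hq)

theorem supportFiltration_eq_top {μ : Fin r → ℤ} (h : μ ≤ 0) :
    supportFiltration (n := n) p μ = ⊤ :=
  Ideal.eq_top_iff_one _ |>.mpr fun q _ => h.trans (pairings_nonneg p q)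

/-- The vector of weight orders of `g`. -/
def weightOrders (g : HoloGerm n) : Fin r → ℤ := fun j => weightOrder (p j) g

theorem mem_supportFiltration_weightOrders (g : HoloGerm n) :
    g ∈ supportFiltration p (weightOrders p g) := by
  intro q hq j
  exact Int.ofNat_le.mpr (Nat.sInf_le ⟨q, hq, rfl⟩)

/-- The exponents that contribute to `F_μ / F_{μ+𝟏}`. -/
def gradedSupport (μ : Fin r → ℤ) : Set (Fin n →₀ ℕ) :=
  {q | μ ≤ pairings p q ∧ ¬ μ + 1 ≤ pairings p q}

theorem finite_pairings_not_le {p : Fin r → Fin n → ℕ} (hp : ∀ j l, 0 < p j l) (μ : Fin r → ℤ) :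
    {q : Fin n →₀ ℕ | ¬ μ ≤ pairings p q}.Finite := by
  refine (Set.finite_iUnion fun j => finite_weight_le (hp j) (μ j).toNat).subset fun q hq => ?_
  obtain ⟨j, hj⟩ : ∃ j, ¬ μ j ≤ pairings p q j := by
    by_contra! h
    exact hq h
  refine Set.mem_iUnion.mpr ⟨j, ?_⟩
  change Finsupp.weight (p j) q ≤ _
  rw [← pairing_eq_weight]
  simp only [pairings] at hj
  omega

theorem finite_gradedSupport {p : Fin r → Fin n → ℕ} (hp : ∀ j l, 0 < p j l) (μ : Fin r → ℤ) :
    (gradedSupport p μ).Finite :=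
  (finite_pairings_not_le hp (μ + 1)).subset fun _ h => h.2

end AmbientFiltration

/-! ### The Rees algebra of the filtration -/

section Rees

open MvPolynomial

attribute [local instance] MvPolynomial.weightedGradedAlgebra

variable {n r : ℕ} (p : Fin r → Fin n → ℕ)

/-- The Rees algebra `⨁_μ F_μ t^μ` of the polynomial version of the filtration is the polynomial
ring in `Z_l = z_l t^{p^l}` and `u_j = t_j⁻¹`. -/
abbrev ReesRing (n r : ℕ) : Type := MvPolynomial (Fin n ⊕ Fin r) ℂ

/-- The degrees of the variables of the Rees algebra: `deg Z_l = p^l` and `deg u_j = -e_j`. -/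
def reesWeight : Fin n ⊕ Fin r → (Fin r → ℤ) :=
  Sum.elim (fun l j => p j l) fun j => -Pi.single j 1

/-- The homogeneous elements of degree `μ` of the Rees algebra. -/
abbrev reesPiece (μ : Fin r → ℤ) : Submodule ℂ (ReesRing n r) :=
  weightedHomogeneousSubmodule ℂ (reesWeight p) μ

/-- The exponents of the variables `Z_l` in a monomial of the Rees algebra. -/
def fstExponent (s : Fin n ⊕ Fin r →₀ ℕ) : Fin n →₀ ℕ :=
  Finsupp.equivFunOnFinite.symm fun l => s (Sum.inl l)

theorem fstExponent_apply (s : Fin n ⊕ Fin r →₀ ℕ) (l : Fin n) :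
    fstExponent s l = s (Sum.inl l) := rfl

/-- The exponent of `Z^q u^{⟨p, q⟩ - μ}`, the monomial of degree `μ` that represents `z^q`. -/
def reesExponent (μ : Fin r → ℤ) (q : Fin n →₀ ℕ) : Fin n ⊕ Fin r →₀ ℕ :=
  Finsupp.equivFunOnFinite.symm (Sum.elim q fun j => (pairings p q j - μ j).toNat)

theorem reesExponent_inr (μ : Fin r → ℤ) (q : Fin n →₀ ℕ) (j : Fin r) :
    reesExponent p μ q (Sum.inr j) = (pairings p q j - μ j).toNat := rfl

theorem fstExponent_reesExponent (μ : Fin r → ℤ) (q : Fin n →₀ ℕ) :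
    fstExponent (reesExponent p μ q) = q := by
  ext l
  rfl

theorem weight_reesWeight (s : Fin n ⊕ Fin r →₀ ℕ) (j : Fin r) :
    Finsupp.weight (reesWeight p) s j = pairings p (fstExponent s) j - s (Sum.inr j) := by
  classical
  rw [Finsupp.weight_apply, Finsupp.sum_fintype _ _ (by simp), Fintype.sum_sum_type,
    Pi.add_apply, Finset.sum_apply, Finset.sum_apply, pairings, pairing]
  simp only [reesWeight, Sum.elim_inl, Sum.elim_inr, Pi.smul_apply, Pi.neg_apply, Pi.single_apply,
    nsmul_eq_mul, fstExponent_apply]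
  push_cast
  rw [sub_eq_add_neg]
  congr 1
  · exact Finset.sum_congr rfl fun i _ => mul_comm _ _
  · simp

theorem weight_reesExponent {μ : Fin r → ℤ} {q : Fin n →₀ ℕ} (h : μ ≤ pairings p q) :
    Finsupp.weight (reesWeight p) (reesExponent p μ q) = μ := by
  ext j
  rw [weight_reesWeight, fstExponent_reesExponent, reesExponent_inr]
  have h1 : μ j ≤ pairings p q j := h j
  omega

theorem le_pairings_of_weight_eq {μ : Fin r → ℤ} {s : Fin n ⊕ Fin r →₀ ℕ}
    (h : Finsupp.weight (reesWeight p) s = μ) : μ ≤ pairings p (fstExponent s) := by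
  intro j
  change μ j ≤ pairings p (fstExponent s) j
  rw [← h, weight_reesWeight]
  omega

theorem reesExponent_fstExponent {μ : Fin r → ℤ} {s : Fin n ⊕ Fin r →₀ ℕ}
    (h : Finsupp.weight (reesWeight p) s = μ) : reesExponent p μ (fstExponent s) = s := by
  ext i
  rcases i with l | j
  · rfl
  · rw [reesExponent_inr, ← h, weight_reesWeight]
    omega

/-- The specialization `u_j ↦ 1` of the Rees algebra to polynomials in `z`. -/
def dehomogenize (n r : ℕ) : ReesRing n r →ₐ[ℂ] MvPolynomial (Fin n) ℂ :=
  aeval (Sum.elim X fun _ => 1)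

theorem dehomogenize_monomial (s : Fin n ⊕ Fin r →₀ ℕ) (c : ℂ) :
    dehomogenize n r (monomial s c) = monomial (fstExponent s) c := by
  rw [dehomogenize, aeval_monomial, monomial_eq, Finsupp.prod_fintype _ _ (by simp),
    Finsupp.prod_fintype _ _ (by simp), Fintype.prod_sum_type]
  simp [algebraMap_eq, fstExponent_apply]

/-- On elements of degree `μ` the specialization `u ↦ 1` forgets nothing. -/
theorem coeff_dehomogenize {μ : Fin r → ℤ} {a : ReesRing n r} (ha : a ∈ reesPiece p μ)
    (q : Fin n →₀ ℕ) [Decidable (μ ≤ pairings p q)] :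
    coeff q (dehomogenize n r a) =
      if μ ≤ pairings p q then coeff (reesExponent p μ q) a else 0 := by
  classical
  conv_lhs => rw [a.as_sum, map_sum, coeff_sum]
  simp only [dehomogenize_monomial, coeff_monomial]
  have hw : ∀ s ∈ a.support, Finsupp.weight (reesWeight p) s = μ := fun s hs =>
    ha (mem_support_iff.mp hs)
  split_ifs with h
  · rw [Finset.sum_eq_single (reesExponent p μ q)]
    · rw [if_pos (fstExponent_reesExponent p μ q)]
    · intro s hs hne
      rw [if_neg]
      rintro rfl
      exact hne (reesExponent_fstExponent p (hw s hs)).symm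
    · intro hs
      rw [notMem_support_iff.mp hs, ite_self]
  · refine Finset.sum_eq_zero fun s hs => if_neg ?_
    rintro rfl
    exact h (le_pairings_of_weight_eq p (hw s hs))

/-- The specialization `u ↦ 1`, `Z_l ↦ z_l` of the Rees algebra to germs. -/
def reesToGerm (n r : ℕ) : ReesRing n r →ₐ[ℂ] HoloGerm n := (polyGerm n).comp (dehomogenize n r)

theorem germCoeff_reesToGerm {μ : Fin r → ℤ} {a : ReesRing n r} (ha : a ∈ reesPiece p μ)
    (q : Fin n →₀ ℕ) [Decidable (μ ≤ pairings p q)] :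
    germCoeff q (reesToGerm n r a) =
      if μ ≤ pairings p q then coeff (reesExponent p μ q) a else 0 := by
  rw [reesToGerm, AlgHom.comp_apply, germCoeff_polyGerm, coeff_dehomogenize p ha]

theorem reesToGerm_mem {μ : Fin r → ℤ} {a : ReesRing n r} (ha : a ∈ reesPiece p μ) :
    reesToGerm n r a ∈ supportFiltration p μ := by
  classical
  intro q hq
  rw [germCoeff_reesToGerm p ha] at hq
  by_contra h
  exact hq (if_neg h)

/-- The product `u = u₁ ⋯ u_r`, as a monomial. -/
def uProd (n r : ℕ) : ReesRing n r :=
  monomial (Finsupp.equivFunOnFinite.symm (Sum.elim 0 1)) 1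

theorem uProd_dvd_monomial {s : Fin n ⊕ Fin r →₀ ℕ} (h : ∀ j, 1 ≤ s (Sum.inr j)) (c : ℂ) :
    uProd n r ∣ monomial s c := by
  have hle : Finsupp.equivFunOnFinite.symm (Sum.elim 0 1) ≤ s := by
    rintro (l | j)
    · exact Nat.zero_le _
    · exact h j
  refine ⟨monomial (s - Finsupp.equivFunOnFinite.symm (Sum.elim 0 1)) c, ?_⟩
  rw [uProd, monomial_mul, one_mul, add_tsub_cancel_of_le hle]

theorem uProd_mem : uProd n r ∈ reesPiece p (-1) := by
  refine isWeightedHomogeneous_monomial _ _ _ ?_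
  ext j
  rw [weight_reesWeight]
  have : fstExponent (Finsupp.equivFunOnFinite.symm (Sum.elim 0 1) : Fin n ⊕ Fin r →₀ ℕ) = 0 := by
    ext l
    rfl
  rw [this, pairings_zero]
  simp

theorem reesToGerm_uProd : reesToGerm n r (uProd n r) = 1 := by
  rw [reesToGerm, AlgHom.comp_apply, uProd, dehomogenize_monomial]
  have : fstExponent (Finsupp.equivFunOnFinite.symm (Sum.elim 0 1) : Fin n ⊕ Fin r →₀ ℕ) = 0 := by
    ext l
    rfl
  rw [this]
  exact map_one _

theorem mem_span_uProd_of_reesToGerm_mem {μ : Fin r → ℤ} {a : ReesRing n r}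
    (ha : a ∈ reesPiece p μ) (h : reesToGerm n r a ∈ supportFiltration p (μ + 1)) :
    uProd n r ∣ a := by
  classical
  rw [a.as_sum]
  refine Finset.dvd_sum fun s hs => uProd_dvd_monomial (fun j => ?_) _
  have hw : Finsupp.weight (reesWeight p) s = μ := ha (mem_support_iff.mp hs)
  have h1 : (μ + 1) j ≤ pairings p (fstExponent s) j := h (fstExponent s) (by
    rw [germCoeff_reesToGerm p ha, if_pos (le_pairings_of_weight_eq p hw),
      reesExponent_fstExponent p hw]
    exact mem_support_iff.mp hs) j
  rw [← hw, Pi.add_apply, weight_reesWeight, Pi.one_apply] at h1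
  omega

variable (hp : ∀ j l, 0 < p j l)

/-- The element of degree `μ` of the Rees algebra that represents the class of a germ in
`F_μ / F_{μ+𝟏}`. -/
def reesLift (μ : Fin r → ℤ) (f : HoloGerm n) : ReesRing n r :=
  ∑ q ∈ (finite_gradedSupport hp μ).toFinset, monomial (reesExponent p μ q) (germCoeff q f)

theorem reesLift_mem (μ : Fin r → ℤ) (f : HoloGerm n) : reesLift p hp μ f ∈ reesPiece p μ := by
  refine Submodule.sum_mem _ fun q hq => isWeightedHomogeneous_monomial _ _ _ ?_
  exact weight_reesExponent p ((finite_gradedSupport hp μ).mem_toFinset.mp hq).1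

theorem reesToGerm_reesLift_sub_mem {μ : Fin r → ℤ} {f : HoloGerm n}
    (hf : f ∈ supportFiltration p μ) :
    f - reesToGerm n r (reesLift p hp μ f) ∈ supportFiltration p (μ + 1) := by
  classical
  intro q hq
  by_contra hle
  apply hq
  rw [germCoeff_sub, reesToGerm, AlgHom.comp_apply, germCoeff_polyGerm, reesLift, map_sum,
    coeff_sum]
  simp only [dehomogenize_monomial, fstExponent_reesExponent, coeff_monomial]
  rw [Finset.sum_ite_eq']
  split_ifs with h
  · exact sub_self _
  · rw [sub_zero]
    by_contra hne
    exact h ((finite_gradedSupport hp μ).mem_toFinset.mpr ⟨hf q hne, hle⟩)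

end Rees

/-! ### The dimension of the zero locus of the homogenized equations -/

section Dimension

open MvPolynomial

variable {n r : ℕ} {p : Fin r → Fin n → ℕ} (hp : ∀ j l, 0 < p j l)

theorem algHom_monomial {ι K : Type*} [Fintype ι] [CommRing K] [Algebra ℂ K]
    (ev : MvPolynomial ι ℂ →ₐ[ℂ] K) (s : ι →₀ ℕ) (c : ℂ) :
    ev (monomial s c) = algebraMap ℂ K c * ∏ i, ev (X i) ^ s i := by
  conv_lhs => rw [aeval_unique ev]
  rw [aeval_monomial, Finsupp.prod_fintype _ _ (by simp)]
  rfl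

open Classical in
theorem germCoeff_initialPart (J : Finset (Fin r)) (f : HoloGerm n) (q : Fin n →₀ ℕ) :
    germCoeff q (initialPart p J f) =
      if ∀ j ∈ J, pairing (p j) q = weightOrder (p j) f then germCoeff q f else 0 := rfl

/-- Over a field in which exactly the `u_j`, `j ∈ J`, vanish, the torus coordinates `u_j`, `j ∉ J`,
can be absorbed into `z`; this turns the homogenization of `f` into the initial part of `f`. -/
theorem aeval_initialPart {K : Type*} [Field K] [Algebra ℂ K] (ev : ReesRing n r →ₐ[ℂ] K)
    (J : Finset (Fin r)) (hJ : ∀ j, j ∈ J ↔ ev (X (Sum.inr j)) = 0) {j₀ : Fin r} (hj₀ : j₀ ∈ J)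
    (f : HoloGerm n) :
    aeval (fun l => ev (X (Sum.inl l)) * ∏ j ∈ Jᶜ, ev (X (Sum.inr j)) ^ p j l)
        (germComponent (hp j₀) (weightOrder (p j₀) f) (initialPart p J f)) =
      (∏ j ∈ Jᶜ, ev (X (Sum.inr j)) ^ weightOrder (p j) f) *
        ev (reesLift p hp (weightOrders p f) f) := by
  classical
  set z : Fin n → K := fun l => ev (X (Sum.inl l))
  set U : Fin r → K := fun j => ev (X (Sum.inr j))
  rw [germComponent, reesLift, map_sum, map_sum, Finset.mul_sum]
  set E := (finite_gradedSupport hp (weightOrders p f)).toFinset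
  set F := (finite_weight_eq (hp j₀) (weightOrder (p j₀) f)).toFinset
  have hE : ∀ q, q ∈ E ↔ q ∈ gradedSupport p (weightOrders p f) := fun q =>
    (finite_gradedSupport hp (weightOrders p f)).mem_toFinset
  have hF : ∀ q, q ∈ F ↔ pairing (p j₀) q = weightOrder (p j₀) f := fun q => by
    rw [pairing_eq_weight]
    exact (finite_weight_eq (hp j₀) (weightOrder (p j₀) f)).mem_toFinset
  have hev : ∀ q, ev (monomial (reesExponent p (weightOrders p f) q) (germCoeff q f)) =
      algebraMap ℂ K (germCoeff q f) * ((∏ l, z l ^ q l) *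
        ∏ j, U j ^ (pairings p q j - weightOrders p f j).toNat) := by
    intro q
    rw [algHom_monomial, Fintype.prod_sum_type]
    rfl
  have hle : ∀ q ∈ E, ∀ j, weightOrder (p j) f ≤ pairing (p j) q := fun q hq j =>
    Int.ofNat_le.mp (((hE q).mp hq).1 j)
  have hvanish : ∀ q ∈ E, ∀ j ∈ J, pairing (p j) q ≠ weightOrder (p j) f →
      ∏ j, U j ^ (pairings p q j - weightOrders p f j).toNat = 0 := by
    intro q hq j hj hne
    refine Finset.prod_eq_zero (Finset.mem_univ j) ?_
    rw [show U j = 0 from (hJ j).mp hj, zero_pow]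
    have := hle q hq j
    simp only [pairings, weightOrders]
    omega
  -- the terms with exponents outside `E ∩ F` vanish in both sums
  rw [← Finset.sum_subset (Finset.inter_subset_right (s₁ := E) (s₂ := F)),
    ← Finset.sum_subset (Finset.inter_subset_left (s₁ := E) (s₂ := F))]
  · refine Finset.sum_congr rfl fun q hq => ?_
    obtain ⟨hqE, hqF⟩ := Finset.mem_inter.mp hq
    rw [hev, aeval_monomial, Finsupp.prod_fintype _ _ (by simp), germCoeff_initialPart]
    split_ifs with hin
    · rw [mul_left_comm]
      congr 1
      have h1 : ∏ j, U j ^ (pairings p q j - weightOrders p f j).toNat =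
          ∏ j ∈ Jᶜ, U j ^ (pairing (p j) q - weightOrder (p j) f) := by
        rw [← Finset.prod_mul_prod_compl J, Finset.prod_eq_one, one_mul]
        · refine Finset.prod_congr rfl fun j _ => ?_
          congr 1
          simp only [pairings, weightOrders]
          omega
        · intro j hj
          simp [pairings, weightOrders, hin j hj]
      rw [h1, mul_left_comm, ← Finset.prod_mul_distrib]
      have h2 : ∀ j ∈ Jᶜ, U j ^ weightOrder (p j) f * U j ^ (pairing (p j) q - weightOrder (p j) f)
          = ∏ l, (U j ^ p j l) ^ q l := by
        intro j _
        rw [← pow_add, Nat.add_sub_cancel' (hle q hqE j), pairing, ← Finset.prod_pow_eq_pow_sum]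
        exact Finset.prod_congr rfl fun l _ => pow_mul _ _ _
      rw [Finset.prod_congr rfl h2, Finset.prod_comm, ← Finset.prod_mul_distrib]
      refine Finset.prod_congr rfl fun l _ => ?_
      rw [mul_pow, Finset.prod_pow]
    · push Not at hin
      obtain ⟨j, hj, hne⟩ := hin
      rw [hvanish q hqE j hj hne]
      simp
  · intro q hqE hq
    have hqF : pairing (p j₀) q ≠ weightOrder (p j₀) f := fun h =>
      hq (Finset.mem_inter.mpr ⟨hqE, (hF q).mpr h⟩)
    rw [hev, hvanish q hqE j₀ hj₀ hqF]
    simp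
  · intro q hqF hq
    have : germCoeff q f = 0 := by
      by_contra hne
      refine hq (Finset.mem_inter.mpr ⟨(hE q).mpr ⟨mem_supportFiltration_weightOrders p f q hne,
        fun h => ?_⟩, hqF⟩)
      have h1 : weightOrders p f j₀ + 1 ≤ pairings p q j₀ := h j₀
      have h2 := (hF q).mp hqF
      simp only [pairings, weightOrders] at h1
      omega
    rw [germCoeff_initialPart, this, ite_self, map_zero, map_zero]

/-- A prime of the Rees algebra that contains `u` and the homogenized equations has codimension at
least `k + 1`: its residue field is algebraic over the parameters of the initial parts with respect
to the `u_j` that vanish, together with the other `u_j`. -/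
theorem ringKrullDim_quotient_prime_le {k : ℕ} (g : Fin k → HoloGerm n)
    (hg0 : ∀ i, germCoeff 0 (g i) = 0)
    (hcodim : ∀ J : Finset (Fin r), J.Nonempty →
      CodimAtLeast (Ideal.span (Set.range fun i => initialPart p J (g i))) ((k : ℤ) - J.card + 1))
    (Q : Ideal (ReesRing n r)) (hQ : Q.IsPrime) (hu : uProd n r ∈ Q)
    (hG : ∀ i, reesLift p hp (weightOrders p (g i)) (g i) ∈ Q) :
    ∃ e : ℕ, ringKrullDim (ReesRing n r ⧸ Q) ≤ e ∧ e + (k + 1) ≤ n + r := by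
  classical
  let D := ReesRing n r ⧸ Q
  let K := FractionRing D
  let ev : ReesRing n r →ₐ[ℂ] K := (IsScalarTower.toAlgHom ℂ D K).comp (Ideal.Quotient.mkₐ ℂ Q)
  have hev : ∀ a, ev a = 0 ↔ a ∈ Q := fun a => by
    change algebraMap D K (Ideal.Quotient.mk Q a) = 0 ↔ _
    rw [map_eq_zero_iff _ (IsFractionRing.injective D K), Ideal.Quotient.eq_zero_iff_mem]
  let J : Finset (Fin r) := Finset.univ.filter fun j => ev (X (Sum.inr j)) = 0
  have hJ : ∀ j, j ∈ J ↔ ev (X (Sum.inr j)) = 0 := fun j => by simp [J]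
  have hJne : J.Nonempty := by
    have h1 : ev (uProd n r) = 0 := (hev _).mpr hu
    rw [uProd, algHom_monomial, map_one, one_mul, Fintype.prod_sum_type] at h1
    simp only [Finsupp.equivFunOnFinite_symm_apply_apply, Sum.elim_inl, Sum.elim_inr, Pi.zero_apply,
      Pi.one_apply, pow_zero, pow_one, Finset.prod_const_one, one_mul] at h1
    obtain ⟨j, -, hj⟩ := Finset.prod_eq_zero_iff.mp h1
    exact ⟨j, (hJ j).mpr hj⟩
  obtain ⟨j₀, hj₀⟩ := hJne
  let z' : Fin n → K := fun l => ev (X (Sum.inl l)) * ∏ j ∈ Jᶜ, ev (X (Sum.inr j)) ^ p j l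
  obtain ⟨T, hT, hint⟩ := exists_parameters_of_codimAtLeast (hp j₀)
    (fun i => initialPart p J (g i)) (fun i => weightOrder (p j₀) (g i))
    (fun i q hq => by
      rw [← pairing_eq_weight]
      by_contra hne
      refine hq ?_
      rw [germCoeff_initialPart, if_neg]
      exact fun h => hne (h j₀ hj₀))
    (fun i => by rw [germCoeff_initialPart, hg0, ite_self]) (hcodim J ⟨j₀, hj₀⟩)
  have hz' := hint (aeval z') fun i => by
    rw [aeval_initialPart hp ev J hJ hj₀, (hev _).mpr (hG i), mul_zero]
  -- `T` has at most `n - (k - |J| + 1)` elements, and there are `r - |J|` indices `j ∉ J`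
  let S : Finset K := T.image (aeval z') ∪ Jᶜ.image fun j => ev (X (Sum.inr j))
  have hScard : S.card + (k + 1) ≤ n + r := by
    have h1 : S.card ≤ T.card + Jᶜ.card :=
      (Finset.card_union_le _ _).trans (add_le_add Finset.card_image_le Finset.card_image_le)
    have h2 := Finset.card_add_card_compl J
    rw [Fintype.card_fin] at h2
    omega
  refine ⟨S.card, ?_, hScard⟩
  have hmono : Algebra.adjoin ℂ (aeval z' '' (T : Set (MvPolynomial (Fin n) ℂ))) ≤
      Algebra.adjoin ℂ (S : Set K) := by
    refine Algebra.adjoin_mono ?_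
    rintro _ ⟨t, ht, rfl⟩
    exact Finset.mem_coe.mpr (Finset.mem_union_left _ (Finset.mem_image_of_mem _ ht))
  have hU : ∀ j, IsAlgebraic (Algebra.adjoin ℂ (S : Set K)) (ev (X (Sum.inr j))) := by
    intro j
    by_cases hj : j ∈ J
    · rw [(hJ j).mp hj]
      exact isAlgebraic_zero
    · have : ev (X (Sum.inr j)) ∈ Algebra.adjoin ℂ (S : Set K) :=
        Algebra.subset_adjoin (Finset.mem_coe.mpr (Finset.mem_union_right _
          (Finset.mem_image_of_mem _ (Finset.mem_compl.mpr hj))))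
      exact isAlgebraic_algebraMap (⟨_, this⟩ : Algebra.adjoin ℂ (S : Set K))
  have hz'alg : ∀ l, IsAlgebraic (Algebra.adjoin ℂ (S : Set K)) (z' l) := by
    intro l
    have h1 := hz' l
    rw [aeval_X] at h1
    algebraize [(Subalgebra.inclusion hmono).toRingHom]
    have : IsScalarTower (Algebra.adjoin ℂ (aeval z' '' (T : Set (MvPolynomial (Fin n) ℂ))))
        (Algebra.adjoin ℂ (S : Set K)) K := IsScalarTower.of_algebraMap_eq fun _ => rfl
    exact h1.tower_top.isAlgebraic
  have hz : ∀ l, IsAlgebraic (Algebra.adjoin ℂ (S : Set K)) (ev (X (Sum.inl l))) := by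
    intro l
    have hne : (∏ j ∈ Jᶜ, ev (X (Sum.inr j)) ^ p j l) ≠ 0 := by
      rw [Finset.prod_ne_zero_iff]
      exact fun j hj => pow_ne_zero _ fun h => Finset.mem_compl.mp hj ((hJ j).mpr h)
    have h1 : ev (X (Sum.inl l)) = z' l * (∏ j ∈ Jᶜ, ev (X (Sum.inr j)) ^ p j l)⁻¹ := by
      rw [mul_inv_cancel_right₀ hne]
    rw [h1]
    refine (hz'alg l).mul (IsAlgebraic.inv ?_)
    refine Finset.prod_induction _ (fun x => IsAlgebraic (Algebra.adjoin ℂ (S : Set K)) x)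
      (fun _ _ h h' => h.mul h') isAlgebraic_one fun j _ => (hU j).pow _
  refine ringKrullDim_le_card_of_isAlgebraic (k := ℂ) (D := D) (K := K) S
    (Set.range fun i => Ideal.Quotient.mkₐ ℂ Q (X i)) ?_ ?_
  · rw [Set.range_comp', ← AlgHom.map_adjoin, adjoin_range_X, Algebra.map_top]
    exact (AlgHom.range_eq_top _).mpr (Ideal.Quotient.mkₐ_surjective ℂ Q)
  · rintro _ ⟨i | j, rfl⟩
    exacts [hz i, hU j]

end Dimension

/-! ### The homogenized equations form a regular sequence -/

section RegularSequence

open MvPolynomial RingTheory.Sequence IsLocalRing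

theorem isWeaklyRegular_map_X {ι : Type*} (l : List ι) (hl : l.Nodup) :
    IsWeaklyRegular (MvPolynomial ι ℂ) (l.map (X (R := ℂ))) := by
  classical
  refine ⟨fun i hi => ?_⟩
  have hi' : i < l.length := by simpa using hi
  rw [isSMulRegular_quotient_iff_mem_of_smul_mem]
  have hideal : Ideal.ofList (List.take i (l.map (X (R := ℂ)))) • (⊤ : Ideal (MvPolynomial ι ℂ)) =
      Ideal.span (X '' {s | s ∈ List.take i l}) := by
    rw [smul_eq_mul, Ideal.mul_top, ← List.map_take, Ideal.ofList]
    congr 1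
    ext x
    simp only [Set.mem_ofPred_eq, List.mem_map, Set.mem_image]
  rw [hideal, List.getElem_map]
  intro x hx
  rw [mem_ideal_span_X_image] at hx ⊢
  intro m hm
  have h1 : m + Finsupp.single (l[i]'hi') 1 ∈
      (X (R := ℂ) (l[i]'hi') • x).support := by
    rw [mem_support_iff, smul_eq_mul, add_comm, coeff_X_mul]
    exact mem_support_iff.mp hm
  obtain ⟨s, hs, hne⟩ := hx _ h1
  refine ⟨s, hs, ?_⟩
  have hsi : l[i] ≠ s := by
    rintro rfl
    obtain ⟨j, hj, hji⟩ := List.mem_take_iff_getElem.mp hs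
    have := hl.getElem_inj_iff.mp hji
    omega
  rwa [Finsupp.add_apply, Finsupp.single_eq_of_ne hsi.symm, add_zero] at hne

/-- A bound for the dimension of all residue domains bounds the dimension of a quotient of a
localization. -/
theorem supportDim_localization_le {A : Type} [CommRing A] (m : Ideal A) [m.IsPrime]
    (I : Ideal (Localization.AtPrime m)) {c N : ℕ} (hcN : c ≤ N)
    (h : ∀ Q : Ideal A, Q.IsPrime → I.comap (algebraMap A _) ≤ Q →
      ∃ e : ℕ, ringKrullDim (A ⧸ Q) ≤ e ∧ e + c ≤ N) :
    Module.supportDim (Localization.AtPrime m)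
      (Localization.AtPrime m ⧸ I • (⊤ : Ideal (Localization.AtPrime m))) + c ≤ N := by
  set B := Localization.AtPrime m
  have hsup : Module.supportDim B (B ⧸ I • (⊤ : Ideal B)) ≤ (N - c : ℕ) := by
    refine iSup_le fun s => ?_
    have h0 : I ≤ (s 0).1.asIdeal := by
      have h1 := (Module.support_quotient (R := B) (M := B) I).le (s 0).2
      exact h1.2
    obtain ⟨e, he, hec⟩ := h _ ((s 0).1.isPrime.comap (algebraMap A B)) (Ideal.comap_mono h0)
    rw [ringKrullDim_quotient] at he
    let s' : LTSeries (PrimeSpectrum.zeroLocus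
        (((s 0).1.asIdeal.comap (algebraMap A B) : Ideal A) : Set A)) :=
      { length := s.length
        toFun := fun i => ⟨PrimeSpectrum.comap (algebraMap A B) (s i).1,
          Ideal.comap_mono (s.monotone (Fin.zero_le i))⟩
        step := fun i => (IsLocalization.orderEmbedding m.primeCompl B).lt_iff_lt.mpr (s.step i) }
    have h1 : (s.length : WithBot ℕ∞) ≤ e := (Order.LTSeries.length_le_krullDim s').trans he
    have h2 : s.length ≤ e := by exact_mod_cast h1
    have h3 : s.length ≤ N - c := by omega
    exact_mod_cast h3
  calc _ ≤ ((N - c : ℕ) : WithBot ℕ∞) + c := by gcongr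
    _ = N := by
      rw [← Nat.cast_add]
      congr 1
      omega

variable {n r : ℕ}

/-- The maximal homogeneous ideal of the Rees algebra, the ideal of the origin. -/
def originIdeal (n r : ℕ) : Ideal (ReesRing n r) := RingHom.ker (constantCoeff (R := ℂ))

instance : (originIdeal n r).IsPrime := RingHom.ker_isPrime _

/-- The variables form a regular sequence, so the local ring of the Rees algebra at the origin has
depth `n + r`. -/
theorem exists_isRegular_localization :
    ∃ rs : List (Localization.AtPrime (originIdeal n r)), rs.length = n + r ∧
      (∀ y ∈ rs, y ∈ maximalIdeal (Localization.AtPrime (originIdeal n r))) ∧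
      IsRegular (Localization.AtPrime (originIdeal n r)) rs := by
  have hmem : ∀ y ∈ ((Finset.univ : Finset (Fin n ⊕ Fin r)).toList.map (X (R := ℂ))).map
      (algebraMap (ReesRing n r) (Localization.AtPrime (originIdeal n r))),
      y ∈ maximalIdeal (Localization.AtPrime (originIdeal n r)) := by
    intro y hy
    obtain ⟨x, hx, rfl⟩ := List.mem_map.mp hy
    obtain ⟨s, -, rfl⟩ := List.mem_map.mp hx
    rw [IsLocalization.AtPrime.to_map_mem_maximal_iff _ (originIdeal n r)]
    simp [originIdeal, RingHom.mem_ker]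
  refine ⟨_, ?_, hmem, ?_⟩
  · simp
  · exact IsRegular.of_isWeaklyRegular_of_mem_maximalIdeal _ hmem
      (IsWeaklyRegular.of_isLocalization _ (originIdeal n r).primeCompl
        (isWeaklyRegular_map_X _ (Finset.nodup_toList _)))

theorem uProd_mem_originIdeal (hr : 0 < r) : uProd n r ∈ originIdeal n r := by
  classical
  rw [originIdeal, RingHom.mem_ker, constantCoeff_eq, uProd, coeff_monomial, if_neg]
  intro h
  have := DFunLike.congr_fun h (Sum.inr ⟨0, hr⟩)
  simp at this

variable {p : Fin r → Fin n → ℕ} (hp : ∀ j l, 0 < p j l)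

theorem reesLift_mem_originIdeal (μ : Fin r → ℤ) {f : HoloGerm n} (hf : germCoeff 0 f = 0) :
    reesLift p hp μ f ∈ originIdeal n r := by
  classical
  rw [reesLift]
  refine Ideal.sum_mem _ fun q _ => ?_
  rw [originIdeal, RingHom.mem_ker, constantCoeff_eq, coeff_monomial]
  split_ifs with h
  · have : q = 0 := by
      rw [← fstExponent_reesExponent p μ q, h]
      ext l
      rfl
    rw [this, hf]
  · rfl

/-- The list `u, G₁, …, G_k`. -/
def equationList {k : ℕ} (g : Fin k → HoloGerm n) : List (ReesRing n r) :=
  uProd n r :: List.ofFn fun i => reesLift p hp (weightOrders p (g i)) (g i)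

theorem isRegular_equationList (hr : 0 < r) {k : ℕ} (g : Fin k → HoloGerm n)
    (hg0 : ∀ i, germCoeff 0 (g i) = 0)
    (hcodim : ∀ J : Finset (Fin r), J.Nonempty →
      CodimAtLeast (Ideal.span (Set.range fun i => initialPart p J (g i))) ((k : ℤ) - J.card + 1)) :
    IsRegular (Localization.AtPrime (originIdeal n r))
      ((equationList hp g).map
        (algebraMap (ReesRing n r) (Localization.AtPrime (originIdeal n r)))) := by
  have hmemO : ∀ x ∈ equationList hp g, x ∈ originIdeal n r := by
    intro x hx
    rcases List.mem_cons.mp hx with rfl | hx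
    · exact uProd_mem_originIdeal hr
    · obtain ⟨i, rfl⟩ := List.mem_ofFn.mp hx
      exact reesLift_mem_originIdeal hp _ (hg0 i)
  refine isRegular_of_supportDim_le _ (d := n + r) ?_ exists_isRegular_localization ?_
  · intro y hy
    obtain ⟨x, hx, rfl⟩ := List.mem_map.mp hy
    rw [IsLocalization.AtPrime.to_map_mem_maximal_iff _ (originIdeal n r)]
    exact hmemO x hx
  · have hdim : ∀ Q : Ideal (ReesRing n r), Q.IsPrime → (∀ x ∈ equationList hp g, x ∈ Q) →
        ∃ e : ℕ, ringKrullDim (ReesRing n r ⧸ Q) ≤ e ∧ e + (k + 1) ≤ n + r := by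
      intro Q hQ hmem
      exact ringKrullDim_quotient_prime_le hp g hg0 hcodim Q hQ (hmem _ List.mem_cons_self)
        fun i => hmem _ (List.mem_cons_of_mem _ (List.mem_ofFn.mpr ⟨i, rfl⟩))
    have hlen : ((equationList hp g).map
        (algebraMap (ReesRing n r) (Localization.AtPrime (originIdeal n r)))).length = k + 1 := by
      simp [equationList]
    rw [hlen]
    refine supportDim_localization_le _ _ ?_ fun Q hQ hle => hdim Q hQ fun x hx => hle ?_
    · obtain ⟨e, -, he⟩ := hdim (originIdeal n r) inferInstance hmemO
      omega
    · exact Ideal.subset_span (List.mem_map_of_mem hx)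

attribute [local instance] MvPolynomial.weightedGradedAlgebra

theorem weightedHomogeneousComponent_mul_of_mem {a b : ReesRing n r} {μ ν : Fin r → ℤ}
    (hb : b ∈ reesPiece p ν) :
    weightedHomogeneousComponent (reesWeight p) (μ + ν) (a * b) =
      weightedHomogeneousComponent (reesWeight p) μ a * b := by
  rw [← decompose_eq_weightedHomogeneousComponent, ← decompose_eq_weightedHomogeneousComponent,
    DirectSum.coe_decompose_mul_add_of_right_mem _ hb]

include hp in
/-- The elements of degree zero of the Rees algebra are constant modulo `u`. -/
theorem uProd_dvd_component_zero_sub (a : ReesRing n r) :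
    uProd n r ∣ weightedHomogeneousComponent (reesWeight p) 0 a - C (constantCoeff a) := by
  classical
  set b := weightedHomogeneousComponent (reesWeight p) 0 a - C (constantCoeff a) with hb
  rw [b.as_sum]
  refine Finset.dvd_sum fun s hs => uProd_dvd_monomial (fun j => ?_) _
  have hs' := mem_support_iff.mp hs
  rw [hb, coeff_sub, coeff_weightedHomogeneousComponent, coeff_C, constantCoeff_eq] at hs'
  have hs0 : s ≠ 0 := by
    rintro rfl
    simp at hs'
  rw [if_neg hs0.symm, sub_zero] at hs'
  have hw : Finsupp.weight (reesWeight p) s = 0 := by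
    by_contra h
    exact hs' (if_neg h)
  have hwj : ∀ j, pairings p (fstExponent s) j = s (Sum.inr j) := fun j => by
    have := congrFun hw j
    rw [weight_reesWeight, Pi.zero_apply] at this
    omega
  have hfst : fstExponent s ≠ 0 := by
    intro h0
    apply hs0
    ext i
    rcases i with l | j
    · exact DFunLike.congr_fun h0 l
    · have := hwj j
      rw [h0, pairings_zero] at this
      simpa using this.symm
  have hpos : pairings p (fstExponent s) j ≠ 0 := by
    intro h0
    apply hfst
    rw [← weight_eq_zero_iff (hp j), ← pairing_eq_weight]
    exact Int.ofNat_eq_zero.mp h0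
  have := hwj j
  omega

/-- The ideal generated by `u` and the first `i` homogenized equations. -/
def equationIdeal {k : ℕ} (g : Fin k → HoloGerm n) (i : ℕ) : Ideal (ReesRing n r) :=
  Ideal.ofList (List.take (i + 1) (equationList hp g))

theorem equationIdeal_eq {k : ℕ} (g : Fin k → HoloGerm n) (i : ℕ) :
    equationIdeal hp g i = Ideal.span {uProd n r} ⊔
      Ideal.span ((fun l : Fin k => reesLift p hp (weightOrders p (g l)) (g l)) ''
        {l : Fin k | (l : ℕ) < i}) := by
  rw [equationIdeal, equationList, List.take_succ_cons, Ideal.ofList_cons, Ideal.ofList]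
  congr 2
  ext x
  simp only [List.mem_take_iff_getElem, List.getElem_ofFn, Set.mem_ofPred_eq, Set.mem_image,
    List.length_ofFn, lt_inf_iff]
  constructor
  · rintro ⟨l, hl, rfl⟩
    exact ⟨⟨l, hl.2⟩, hl.1, rfl⟩
  · rintro ⟨l, hl, rfl⟩
    exact ⟨l, ⟨hl, l.2⟩, rfl⟩

theorem isHomogeneous_equationIdeal {k : ℕ} (g : Fin k → HoloGerm n) (i : ℕ) :
    (equationIdeal hp g i).IsHomogeneous (reesPiece p) := by
  rw [equationIdeal_eq]
  refine Ideal.IsHomogeneous.sup (Ideal.homogeneous_span _ _ ?_) (Ideal.homogeneous_span _ _ ?_)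
  · rintro _ rfl
    exact ⟨-1, uProd_mem p⟩
  · rintro _ ⟨l, -, rfl⟩
    exact ⟨_, reesLift_mem p hp _ _⟩

/-- Regularity in the local ring of the origin descends to the graded ring, because an element of
degree zero that does not vanish at the origin is a unit modulo `u`. -/
theorem mem_equationIdeal_of_mul_mem (hr : 0 < r) {k : ℕ} (g : Fin k → HoloGerm n)
    (hg0 : ∀ i, germCoeff 0 (g i) = 0)
    (hcodim : ∀ J : Finset (Fin r), J.Nonempty →
      CodimAtLeast (Ideal.span (Set.range fun i => initialPart p J (g i))) ((k : ℤ) - J.card + 1))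
    (i : Fin k) {μ : Fin r → ℤ} {x : ReesRing n r} (hx : x ∈ reesPiece p μ)
    (h : reesLift p hp (weightOrders p (g i)) (g i) * x ∈ equationIdeal hp g i) :
    x ∈ equationIdeal hp g i := by
  have hreg := (isRegular_equationList hp hr g hg0 hcodim).toIsWeaklyRegular.regular_mod_prev
    (i + 1) (by simp [equationList])
  rw [isSMulRegular_quotient_iff_mem_of_smul_mem] at hreg
  have hI : Ideal.ofList (List.take (i + 1) ((equationList hp g).map
      (algebraMap (ReesRing n r) (Localization.AtPrime (originIdeal n r))))) •
      (⊤ : Ideal (Localization.AtPrime (originIdeal n r))) =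
      (equationIdeal hp g i).map (algebraMap _ _) := by
    rw [smul_eq_mul, Ideal.mul_top, ← List.map_take, equationIdeal, Ideal.map_ofList]
  rw [hI] at hreg
  have h1 := hreg (algebraMap _ _ x) (by
    rw [smul_eq_mul, List.getElem_map, ← map_mul]
    refine Ideal.mem_map_of_mem _ ?_
    simpa [equationList] using h)
  rw [IsLocalization.algebraMap_mem_map_algebraMap_iff (originIdeal n r).primeCompl] at h1
  obtain ⟨s, hs, hsx⟩ := h1
  -- the component of degree `μ` of `s * x`
  have h2 : weightedHomogeneousComponent (reesWeight p) 0 s * x ∈ equationIdeal hp g i := by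
    rw [← weightedHomogeneousComponent_mul_of_mem hx, zero_add]
    exact weightedHomogeneousComponent_mem_of_mem ℂ _ (isHomogeneous_equationIdeal hp g i) hsx _
  have hu : uProd n r ∈ equationIdeal hp g i := by
    rw [equationIdeal_eq]
    exact le_sup_left (a := Ideal.span {uProd n r}) (Ideal.mem_span_singleton_self _)
  have h3 : C (constantCoeff s) * x ∈ equationIdeal hp g i := by
    have := (equationIdeal hp g i).sub_mem h2 ((equationIdeal hp g i).mul_mem_right x
      (Ideal.mem_of_dvd _ (uProd_dvd_component_zero_sub hp s) hu))
    rwa [← sub_mul, sub_sub_cancel] at this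
  have hc : constantCoeff s ≠ 0 := fun h => hs (RingHom.mem_ker.mpr h)
  exact ((equationIdeal hp g i).unit_mul_mem_iff_mem ((IsUnit.mk0 _ hc).map C)).mp h3

end RegularSequence

/-! ### Regularity of the equations with respect to the filtration -/

section FilteredSum

variable {O : Type*} [CommRing O] {r k : ℕ}

/-- The ideal `∑_{l < i} g_l F_{μ - ν_l}`. -/
def filteredSum (F : (Fin r → ℤ) → Ideal O) (ν : Fin k → Fin r → ℤ) (g : Fin k → O) (i : ℕ)
    (μ : Fin r → ℤ) : Ideal O :=
  ⨆ l : {l : Fin k // (l : ℕ) < i}, Ideal.span {g l} * F (μ - ν l)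

theorem mul_mem_filteredSum {F : (Fin r → ℤ) → Ideal O} {ν : Fin k → Fin r → ℤ} {g : Fin k → O}
    {i : ℕ} {μ : Fin r → ℤ} {l : Fin k} (hl : (l : ℕ) < i) {b : O} (hb : b ∈ F (μ - ν l)) :
    g l * b ∈ filteredSum F ν g i μ :=
  Ideal.mem_iSup_of_mem (⟨l, hl⟩ : {l : Fin k // (l : ℕ) < i})
    (Ideal.mul_mem_mul (Ideal.mem_span_singleton_self _) hb)

theorem filteredSum_le_iff {F : (Fin r → ℤ) → Ideal O} {ν : Fin k → Fin r → ℤ} {g : Fin k → O}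
    {i : ℕ} {μ : Fin r → ℤ} {I : Ideal O} : filteredSum F ν g i μ ≤ I ↔
      ∀ l : Fin k, (l : ℕ) < i → ∀ b ∈ F (μ - ν l), g l * b ∈ I := by
  refine iSup_le_iff.trans ⟨fun h l hl b hb => h ⟨l, hl⟩ (Ideal.mul_mem_mul
    (Ideal.mem_span_singleton_self _) hb), fun h l => ?_⟩
  rw [Ideal.span_singleton_mul_le_iff]
  exact h l l.2

end FilteredSum

section FilteredRegularity

open MvPolynomial

attribute [local instance] MvPolynomial.weightedGradedAlgebra

variable {n r k : ℕ} {p : Fin r → Fin n → ℕ} (hp : ∀ j l, 0 < p j l)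

/-- Representatives modulo the next step of the filtration can be multiplied. -/
theorem mul_sub_reesToGerm_mem {μ ν : Fin r → ℤ} {f g : HoloGerm n} {a b : ReesRing n r}
    (hf : f ∈ supportFiltration p μ) (hb : b ∈ reesPiece p ν)
    (hfa : f - reesToGerm n r a ∈ supportFiltration p (μ + 1))
    (hgb : g - reesToGerm n r b ∈ supportFiltration p (ν + 1)) :
    f * g - reesToGerm n r (a * b) ∈ supportFiltration p (μ + ν + 1) := by
  have h1 := mul_mem_supportFiltration p hf hgb
  have h2 := mul_mem_supportFiltration p hfa (reesToGerm_mem p hb)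
  rw [← add_assoc] at h1
  rw [add_right_comm] at h2
  convert add_mem h1 h2 using 1
  rw [map_mul]
  ring

/-- Every element of `∑_{l < i} g_l F_{μ - ν_l}` is represented modulo `F_{μ+𝟏}` by an element of
the ideal of the homogenized equations. -/
theorem exists_mem_equationIdeal (g : Fin k → HoloGerm n) (i : ℕ) {μ : Fin r → ℤ} {y : HoloGerm n}
    (hy : y ∈ filteredSum (supportFiltration p) (fun l => weightOrders p (g l)) g i μ) :
    ∃ a ∈ reesPiece p μ, a ∈ equationIdeal hp g i ∧
      y - reesToGerm n r a ∈ supportFiltration p (μ + 1) := by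
  induction hy using Submodule.iSup_induction' with
  | zero => exact ⟨0, zero_mem _, zero_mem _, by simp⟩
  | add y z _ _ hy hz =>
    obtain ⟨a, ha, haI, hya⟩ := hy
    obtain ⟨b, hb, hbI, hzb⟩ := hz
    refine ⟨a + b, add_mem ha hb, add_mem haI hbI, ?_⟩
    rw [map_add, add_sub_add_comm]
    exact add_mem hya hzb
  | mem l y hy =>
    obtain ⟨l, hl⟩ := l
    obtain ⟨b, hb, rfl⟩ := Ideal.mem_span_singleton_mul.mp hy
    have hG := reesLift_mem p hp (weightOrders p (g l)) (g l)
    have hB := reesLift_mem p hp (μ - weightOrders p (g l)) b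
    have hgl := mem_supportFiltration_weightOrders p (g l)
    refine ⟨reesLift p hp (weightOrders p (g l)) (g l) *
      reesLift p hp (μ - weightOrders p (g l)) b, ?_, ?_, ?_⟩
    · have := hG.mul hB
      rwa [add_sub_cancel] at this
    · rw [equationIdeal_eq]
      exact Ideal.mul_mem_right _ _ (Ideal.mem_sup_right (Ideal.subset_span ⟨l, hl, rfl⟩))
    · have := mul_sub_reesToGerm_mem hgl hB (reesToGerm_reesLift_sub_mem p hp hgl)
        (reesToGerm_reesLift_sub_mem p hp hb)
      rwa [add_sub_cancel] at this

/-- Setting `u = 1` maps the elements of degree `μ` of the ideal of the homogenized equations into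
`F_{μ+𝟏} + ∑_{l < i} g_l F_{μ - ν_l}`. The factor `c` makes the statement stable under
multiplication of `a` by ring elements. -/
theorem reesToGerm_mem_sup (g : Fin k → HoloGerm n) (i : ℕ) {a : ReesRing n r}
    (ha : a ∈ equationIdeal hp g i) (c : ReesRing n r) (μ : Fin r → ℤ) :
    reesToGerm n r (weightedHomogeneousComponent (reesWeight p) μ (c * a)) ∈
      supportFiltration p (μ + 1) ⊔
        filteredSum (supportFiltration p) (fun l => weightOrders p (g l)) g i μ := by
  have hc : ∀ ρ, weightedHomogeneousComponent (reesWeight p) ρ c ∈ reesPiece p ρ := fun ρ =>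
    weightedHomogeneousComponent_mem _ _ _
  rw [equationIdeal_eq, Ideal.span, Ideal.span, ← Submodule.span_union] at ha
  induction ha using Submodule.span_induction generalizing c with
  | zero => simp
  | add x y _ _ hx hy =>
    rw [mul_add, map_add, map_add]
    exact add_mem (hx c hc) (hy c hc)
  | smul b x _ hx =>
    rw [smul_eq_mul, ← mul_assoc]
    exact hx _ fun ρ => weightedHomogeneousComponent_mem _ _ _
  | mem x hx =>
    rcases hx with rfl | ⟨l, hl, rfl⟩
    · have h1 := weightedHomogeneousComponent_mul_of_mem (a := c) (μ := μ + 1) (uProd_mem (n := n) p)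
      rw [add_neg_cancel_right] at h1
      rw [h1, map_mul, reesToGerm_uProd, mul_one]
      exact Ideal.mem_sup_left (reesToGerm_mem p (hc _))
    · have h1 := weightedHomogeneousComponent_mul_of_mem (a := c) (μ := μ - weightOrders p (g l))
        (reesLift_mem p hp (weightOrders p (g l)) (g l))
      rw [sub_add_cancel] at h1
      rw [h1, map_mul]
      set d := reesToGerm n r
        (weightedHomogeneousComponent (reesWeight p) (μ - weightOrders p (g l)) c)
      have hd : d ∈ supportFiltration p (μ - weightOrders p (g l)) := reesToGerm_mem p (hc _)
      have h2 := mul_mem_supportFiltration p hd (reesToGerm_reesLift_sub_mem p hp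
        (mem_supportFiltration_weightOrders p (g l)))
      rw [← add_assoc, sub_add_cancel] at h2
      have h3 : g l * d ∈
          filteredSum (supportFiltration p) (fun l => weightOrders p (g l)) g i μ :=
        mul_mem_filteredSum hl hd
      have h4 := sub_mem (Ideal.mem_sup_right (S := supportFiltration p (μ + 1)) h3)
        (Ideal.mem_sup_left h2)
      rwa [mul_sub, mul_comm (g l), sub_sub_cancel] at h4

include hp in
/-- The class of `g_i` is a non-zero-divisor on the associated graded module of the quotient by
the preceding equations. -/
theorem mem_sup_of_mul_mem (hr : 0 < r) (g : Fin k → HoloGerm n)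
    (hg0 : ∀ i, germCoeff 0 (g i) = 0)
    (hcodim : ∀ J : Finset (Fin r), J.Nonempty →
      CodimAtLeast (Ideal.span (Set.range fun i => initialPart p J (g i))) ((k : ℤ) - J.card + 1))
    (i : Fin k) {μ : Fin r → ℤ} {x : HoloGerm n} (hx : x ∈ supportFiltration p μ)
    (h : g i * x ∈ supportFiltration p (weightOrders p (g i) + μ + 1) ⊔
      filteredSum (supportFiltration p) (fun l => weightOrders p (g l)) g i
        (weightOrders p (g i) + μ)) :
    x ∈ supportFiltration p (μ + 1) ⊔
      filteredSum (supportFiltration p) (fun l => weightOrders p (g l)) g i μ := by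
  obtain ⟨z, hz, y, hy, hzy⟩ := Submodule.mem_sup.mp h
  obtain ⟨a, ha, haI, hya⟩ := exists_mem_equationIdeal hp g i hy
  have hG := reesLift_mem p hp (weightOrders p (g i)) (g i)
  have hX := reesLift_mem p hp μ x
  have hgi := mem_supportFiltration_weightOrders p (g i)
  have hxX := reesToGerm_reesLift_sub_mem p hp hx
  have h1 := mul_sub_reesToGerm_mem hgi hX (reesToGerm_reesLift_sub_mem p hp hgi) hxX
  have h2 : reesLift p hp (weightOrders p (g i)) (g i) * reesLift p hp μ x ∈
      equationIdeal hp g i := by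
    have hdvd := mem_span_uProd_of_reesToGerm_mem p (sub_mem (hG.mul hX) ha) (by
      convert add_mem (sub_mem hz h1) hya using 1
      rw [← hzy, map_sub]
      ring)
    have hu : uProd n r ∈ equationIdeal hp g i := by
      rw [equationIdeal_eq]
      exact Ideal.mem_sup_left (Ideal.mem_span_singleton_self _)
    have := add_mem (Ideal.mem_of_dvd _ hdvd hu) haI
    rwa [sub_add_cancel] at this
  have h3 := mem_equationIdeal_of_mul_mem hp hr g hg0 hcodim i hX h2
  have h4 := reesToGerm_mem_sup hp g i h3 1 μ
  rw [one_mul, weightedHomogeneousComponent_of_mem hX, if_pos rfl] at h4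
  have := add_mem (Ideal.mem_sup_left hxX) h4
  rwa [sub_add_cancel] at this

end FilteredRegularity

/-! ### Strictness and Hilbert functions -/

section Strictness

variable {O : Type*} [CommRing O] {r k : ℕ}

/-- The sequence `g₁, …, g_k` of elements `g_l ∈ F_{ν_l}` is regular with respect to the
filtration `F`: the class of `g_i` in `F_{ν_i} / F_{ν_i + 𝟏}` is a non-zero-divisor on the quotient
of `⨁_μ F_μ / F_{μ + 𝟏}` by the classes of the `g_l` with `l < i`. -/
structure IsFilteredRegular (F : (Fin r → ℤ) → Ideal O) (ν : Fin k → Fin r → ℤ)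
    (g : Fin k → O) : Prop where
  antitone : Antitone F
  mul_mem : ∀ {μ ρ : Fin r → ℤ} {x y : O}, x ∈ F μ → y ∈ F ρ → x * y ∈ F (μ + ρ)
  eq_top : ∀ {μ : Fin r → ℤ}, μ ≤ 0 → F μ = ⊤
  mem : ∀ i, g i ∈ F (ν i)
  regular : ∀ (i : Fin k) {μ : Fin r → ℤ} {x : O}, x ∈ F μ →
    g i * x ∈ F (ν i + μ + 1) ⊔ filteredSum F ν g i (ν i + μ) →
      x ∈ F (μ + 1) ⊔ filteredSum F ν g i μ

theorem filteredSum_zero (F : (Fin r → ℤ) → Ideal O) (ν : Fin k → Fin r → ℤ) (g : Fin k → O)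
    (μ : Fin r → ℤ) : filteredSum F ν g 0 μ = ⊥ :=
  le_bot_iff.mp (filteredSum_le_iff.mpr fun _ h => absurd h (Nat.not_lt_zero _))

theorem filteredSum_succ (F : (Fin r → ℤ) → Ideal O) (ν : Fin k → Fin r → ℤ) (g : Fin k → O)
    (i : Fin k) (μ : Fin r → ℤ) : filteredSum F ν g (i + 1) μ =
      filteredSum F ν g i μ ⊔ Ideal.span {g i} * F (μ - ν i) := by
  apply le_antisymm
  · refine filteredSum_le_iff.mpr fun l hl b hb => ?_
    rcases Nat.lt_succ_iff_lt_or_eq.mp hl with h | h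
    · exact Ideal.mem_sup_left (mul_mem_filteredSum h hb)
    · obtain rfl := Fin.ext h
      exact Ideal.mem_sup_right (Ideal.mul_mem_mul (Ideal.mem_span_singleton_self _) hb)
  · refine sup_le (filteredSum_le_iff.mpr fun l hl b hb =>
      mul_mem_filteredSum (Nat.lt_succ_of_lt hl) hb) ?_
    rw [Ideal.span_singleton_mul_le_iff]
    exact fun b hb => mul_mem_filteredSum (Nat.lt_succ_self _) hb

namespace IsFilteredRegular

variable {F : (Fin r → ℤ) → Ideal O} {ν : Fin k → Fin r → ℤ} {g : Fin k → O}

theorem add_one_le (h : IsFilteredRegular F ν g) (μ : Fin r → ℤ) : F (μ + 1) ≤ F μ :=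
  h.antitone (le_add_of_nonneg_right zero_le_one)

theorem mul_mem_filteredSum_add (h : IsFilteredRegular F ν g) {i : ℕ} {μ ρ : Fin r → ℤ} {x y : O}
    (hx : x ∈ F ρ) (hy : y ∈ filteredSum F ν g i μ) : x * y ∈ filteredSum F ν g i (ρ + μ) := by
  have : filteredSum F ν g i μ ≤ Submodule.comap (LinearMap.mulLeft O x) (filteredSum F ν g i (ρ + μ)) := by
    refine filteredSum_le_iff.mpr fun l hl b hb => ?_
    rw [Submodule.mem_comap, LinearMap.mulLeft_apply, mul_left_comm]
    refine mul_mem_filteredSum hl ?_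
    rw [add_sub_assoc]
    exact h.mul_mem hx hb
  exact this hy

theorem mul_mem_sup (h : IsFilteredRegular F ν g) {i : ℕ} {μ ρ : Fin r → ℤ} {x y : O}
    (hx : x ∈ F ρ) (hy : y ∈ F (μ + 1) ⊔ filteredSum F ν g i μ) :
    x * y ∈ F (ρ + μ + 1) ⊔ filteredSum F ν g i (ρ + μ) := by
  obtain ⟨a, ha, b, hb, rfl⟩ := Submodule.mem_sup.mp hy
  rw [mul_add, add_assoc]
  exact Submodule.add_mem_sup (h.mul_mem hx ha) (h.mul_mem_filteredSum_add hx hb)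

/-- One step of the proof of strictness. -/
theorem inf_filteredSum_le_add_one (h : IsFilteredRegular F ν g) {i : ℕ} (hi : i ≤ k)
    (μ : Fin r → ℤ) : F (μ + 1) ⊓ filteredSum F ν g i μ ≤ filteredSum F ν g i (μ + 1) := by
  induction i with
  | zero => simp [filteredSum_zero]
  | succ i ih =>
    rintro f ⟨hf, hfi⟩
    have hrec := filteredSum_succ F ν g ⟨i, hi⟩
    simp only at hrec
    have hfi' := hfi
    rw [SetLike.mem_coe, hrec] at hfi'
    obtain ⟨s, hs, _, hgb, rfl⟩ := Submodule.mem_sup.mp hfi'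
    obtain ⟨b, hb, rfl⟩ := Ideal.mem_span_singleton_mul.mp hgb
    have h1 : g ⟨i, hi⟩ * b ∈ F (ν ⟨i, hi⟩ + (μ - ν ⟨i, hi⟩) + 1) ⊔
        filteredSum F ν g i (ν ⟨i, hi⟩ + (μ - ν ⟨i, hi⟩)) := by
      rw [add_sub_cancel]
      have := sub_mem (Ideal.mem_sup_left (T := filteredSum F ν g i μ) hf)
        (Ideal.mem_sup_right hs)
      rwa [add_sub_cancel_left] at this
    -- by regularity, the coefficient of `g_i` lies in the next step of the filtration up to a term
    -- `b₂` that is absorbed by the preceding equations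
    obtain ⟨b₁, hb₁, b₂, hb₂, rfl⟩ := Submodule.mem_sup.mp (h.regular ⟨i, hi⟩ hb h1)
    have h2 := h.mul_mem_filteredSum_add (h.mem ⟨i, hi⟩) hb₂
    rw [add_sub_cancel] at h2
    have h3 := h.mul_mem (h.mem ⟨i, hi⟩) hb₁
    rw [← add_assoc, add_sub_cancel] at h3
    have h4 : s + g ⟨i, hi⟩ * b₂ ∈ F (μ + 1) := by
      have := sub_mem hf h3
      convert this using 1
      ring
    have h5 := ih (by omega) ⟨h4, add_mem hs h2⟩
    rw [hrec]
    have h6 : g ⟨i, hi⟩ * b₁ ∈ Ideal.span {g ⟨i, hi⟩} * F (μ + 1 - ν ⟨i, hi⟩) := by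
      rw [sub_add_eq_add_sub] at hb₁
      exact Ideal.mul_mem_mul (Ideal.mem_span_singleton_self _) hb₁
    convert Submodule.add_mem_sup h5 h6 using 1
    ring

theorem inf_filteredSum_sub_le (h : IsFilteredRegular F ν g) (μ : Fin r → ℤ) (m : ℕ) :
    F μ ⊓ filteredSum F ν g k (μ - (m : Fin r → ℤ)) ≤ filteredSum F ν g k μ := by
  induction m with
  | zero => simp
  | succ m ih =>
    rintro f ⟨hf, hfm⟩
    have hle : μ - ((m + 1 : ℕ) : Fin r → ℤ) + 1 = μ - (m : Fin r → ℤ) := by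
      push_cast
      abel
    refine ih ⟨hf, ?_⟩
    have := h.inf_filteredSum_le_add_one le_rfl (μ - ((m + 1 : ℕ) : Fin r → ℤ))
    rw [hle] at this
    exact this ⟨h.antitone (sub_le_self _ (Nat.cast_nonneg m)) hf, hfm⟩

/-- The filtration is strict with respect to the ideal `(g₁, …, g_k)`: the coefficients in a
representation of an element of `F_μ` start in a very negative step of the filtration, which is the
whole ring, and regularity permits to move them up until they lie in `F_{μ - ν_l}`. -/
theorem inf_span_le (h : IsFilteredRegular F ν g) (μ : Fin r → ℤ) :
    F μ ⊓ Ideal.span (Set.range g) ≤ filteredSum F ν g k μ := by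
  obtain ⟨m, hm⟩ : ∃ m : ℕ, ∀ l, μ - (m : Fin r → ℤ) - ν l ≤ 0 := by
    obtain ⟨m, hm⟩ := Finite.exists_le fun x : Fin k × Fin r => (μ x.2 - ν x.1 x.2).toNat
    refine ⟨m, fun l j => ?_⟩
    have := hm (l, j)
    simp only [Pi.sub_apply, Pi.natCast_apply, Pi.zero_apply] at this ⊢
    omega
  refine (inf_le_inf_left _ (Ideal.span_le.mpr ?_)).trans (h.inf_filteredSum_sub_le μ m)
  rintro _ ⟨l, rfl⟩
  have := mul_mem_filteredSum (F := F) (ν := ν) (g := g) (μ := μ - (m : Fin r → ℤ)) l.2 (b := 1)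
    (by rw [h.eq_top (hm l)]; trivial)
  rwa [mul_one] at this

end IsFilteredRegular

end Strictness

section HilbertFunction

variable {O : Type*} [CommRing O] [Algebra ℂ O] {r k : ℕ}

/-- The graded piece of degree `μ` of the quotient by the classes of `g_l`, `l < i`. -/
abbrev FilteredQuotient (F : (Fin r → ℤ) → Ideal O) (ν : Fin k → Fin r → ℤ) (g : Fin k → O)
    (i : ℕ) (μ : Fin r → ℤ) : Type _ :=
  F μ ⧸ (F (μ + 1) ⊔ filteredSum F ν g i μ).submoduleOf (F μ)

/-- For `i = 0` these are the graded pieces of the filtration. -/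
def filteredQuotientZeroEquiv (F : (Fin r → ℤ) → Ideal O) (ν : Fin k → Fin r → ℤ) (g : Fin k → O)
    (μ : Fin r → ℤ) : FilteredQuotient F ν g 0 μ ≃ₗ[ℂ] GradedPiece F μ :=
  (Submodule.quotEquivOfEq _ _ (by rw [filteredSum_zero, sup_bot_eq])).restrictScalars ℂ

namespace IsFilteredRegular

variable {F : (Fin r → ℤ) → Ideal O} {ν : Fin k → Fin r → ℤ} {g : Fin k → O}

/-- Multiplication by `g_i` gives a short exact sequence of graded pieces. -/
theorem finite_and_finrank_succ (h : IsFilteredRegular F ν g) (i : Fin k) (μ : Fin r → ℤ)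
    (hfin : Module.Finite ℂ (FilteredQuotient F ν g i μ)) :
    Module.Finite ℂ (FilteredQuotient F ν g (i + 1) μ) ∧
      Module.finrank ℂ (FilteredQuotient F ν g i μ) =
        Module.finrank ℂ (FilteredQuotient F ν g (i + 1) μ) +
          Module.finrank ℂ (FilteredQuotient F ν g i (μ - ν i)) := by
  have hmul : ∀ x : F (μ - ν i), g i * x ∈ F μ := fun x => by
    have := h.mul_mem (h.mem i) x.2
    rwa [add_sub_cancel] at this
  let a : F (μ - ν i) →ₗ[O] F μ :=
    ((LinearMap.mulLeft O (g i)).domRestrict _).codRestrict _ hmul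
  have ha : ∀ x, (a x : O) = g i * x := fun _ => rfl
  let M₁ := (F (μ - ν i + 1) ⊔ filteredSum F ν g i (μ - ν i)).submoduleOf (F (μ - ν i))
  let M₂ := (F (μ + 1) ⊔ filteredSum F ν g i μ).submoduleOf (F μ)
  let M₃ := (F (μ + 1) ⊔ filteredSum F ν g (i + 1) μ).submoduleOf (F μ)
  have hM₁ : M₁ = M₂.comap a := by
    ext x
    simp only [M₁, M₂, Submodule.mem_comap, Submodule.submoduleOf, Submodule.coe_subtype, ha]
    constructor
    · intro hx
      have := h.mul_mem_sup (h.mem i) hx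
      rwa [add_sub_cancel] at this
    · intro hx
      refine h.regular i x.2 ?_
      rwa [add_sub_cancel]
  have hM₂₃ : M₂ ≤ M₃ := by
    intro x hx
    simp only [M₂, M₃, Submodule.mem_comap, Submodule.submoduleOf] at hx ⊢
    rw [filteredSum_succ, ← sup_assoc]
    exact Ideal.mem_sup_left hx
  let φ : (F (μ - ν i) ⧸ M₁) →ₗ[O] (F μ ⧸ M₂) := M₁.mapQ M₂ a hM₁.le
  let ψ : (F μ ⧸ M₂) →ₗ[O] (F μ ⧸ M₃) := M₂.mapQ M₃ LinearMap.id hM₂₃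
  have hφ : Function.Injective φ := by
    rw [← LinearMap.ker_eq_bot, Submodule.ker_mapQ, ← hM₁, Submodule.mkQ_map_self]
  have hψ : Function.Surjective ψ := by
    intro y
    obtain ⟨x, rfl⟩ := M₃.mkQ_surjective y
    exact ⟨M₂.mkQ x, rfl⟩
  have hexact : LinearMap.ker ψ = LinearMap.range φ := by
    apply le_antisymm
    · intro y hy
      obtain ⟨x, rfl⟩ := M₂.mkQ_surjective y
      have hx : x ∈ M₃ := by
        rw [← Submodule.Quotient.mk_eq_zero M₃]
        exact hy
      simp only [M₃, Submodule.mem_comap, Submodule.submoduleOf, Submodule.coe_subtype] at hx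
      rw [filteredSum_succ, ← sup_assoc] at hx
      obtain ⟨s, hs, _, hgb, hx⟩ := Submodule.mem_sup.mp hx
      obtain ⟨b, hb, rfl⟩ := Ideal.mem_span_singleton_mul.mp hgb
      refine ⟨M₁.mkQ ⟨b, hb⟩, ?_⟩
      change M₂.mkQ (a ⟨b, hb⟩) = _
      rw [← sub_eq_zero, ← map_sub, Submodule.mkQ_apply, Submodule.Quotient.mk_eq_zero]
      simp only [M₂, Submodule.mem_comap, Submodule.submoduleOf, Submodule.coe_subtype,
        Submodule.coe_sub, ha]
      rw [← neg_mem_iff, ← hx]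
      convert hs using 1
      ring
    · rintro _ ⟨y, rfl⟩
      obtain ⟨x, rfl⟩ := M₁.mkQ_surjective y
      change M₃.mkQ (a x) = 0
      rw [Submodule.mkQ_apply, Submodule.Quotient.mk_eq_zero]
      simp only [M₃, Submodule.mem_comap, Submodule.submoduleOf, Submodule.coe_subtype, ha]
      exact Ideal.mem_sup_right (mul_mem_filteredSum (Nat.lt_succ_self _) x.2)
  have : Module.Finite ℂ (F μ ⧸ M₂) := hfin
  refine ⟨Module.Finite.of_surjective (ψ.restrictScalars ℂ) hψ, ?_⟩
  have h1 := (ψ.restrictScalars ℂ).finrank_range_add_finrank_ker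
  have hrange : LinearMap.range (ψ.restrictScalars ℂ) = ⊤ := LinearMap.range_eq_top.mpr hψ
  rw [hrange, finrank_top, LinearMap.ker_restrictScalars, hexact] at h1
  have h2 := LinearMap.finrank_range_of_inj (f := φ.restrictScalars ℂ) hφ
  change _ = _ + _
  rw [← h2]
  exact h1.symm

theorem finite_filteredQuotient (h : IsFilteredRegular F ν g)
    (hfin : ∀ μ, Module.Finite ℂ (GradedPiece F μ)) {i : ℕ} (hi : i ≤ k) (μ : Fin r → ℤ) :
    Module.Finite ℂ (FilteredQuotient F ν g i μ) := by
  induction i generalizing μ with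
  | zero =>
    have := hfin μ
    exact Module.Finite.equiv (filteredQuotientZeroEquiv F ν g μ).symm
  | succ i ih => exact (h.finite_and_finrank_succ ⟨i, hi⟩ μ (ih (by omega) μ)).1

/-- By strictness, the graded pieces of the induced filtration on `O / (g₁, …, g_k)` are the
quotients of the graded pieces of `F` by the classes of the `g_l`. -/
theorem gradedPiece_equiv (h : IsFilteredRegular F ν g) (μ : Fin r → ℤ) :
    Nonempty (FilteredQuotient F ν g k μ ≃ₗ[ℂ]
      GradedPiece (fun μ => (F μ).map (Ideal.Quotient.mk (Ideal.span (Set.range g)))) μ) := by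
  let I := Ideal.span (Set.range g)
  let π : O →ₐ[ℂ] O ⧸ I := Ideal.Quotient.mkₐ ℂ I
  have hI : filteredSum F ν g k μ ≤ I := filteredSum_le_iff.mpr fun l _ b _ =>
    I.mul_mem_right b (Ideal.subset_span ⟨l, rfl⟩)
  let N := ((F (μ + 1)).map (Ideal.Quotient.mk I)).submoduleOf ((F μ).map (Ideal.Quotient.mk I))
  let a : F μ →ₗ[ℂ] (F μ).map (Ideal.Quotient.mk I) :=
    (π.toLinearMap.domRestrict ((F μ).restrictScalars ℂ)).codRestrict
      (((F μ).map (Ideal.Quotient.mk I)).restrictScalars ℂ)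
      fun x => Ideal.mem_map_of_mem _ x.2
  have ha : ∀ x, (a x : O ⧸ I) = Ideal.Quotient.mk I x := fun _ => rfl
  let b : F μ →ₗ[ℂ] GradedPiece (fun μ => (F μ).map (Ideal.Quotient.mk I)) μ :=
    (N.mkQ.restrictScalars ℂ).comp a
  have hb : Function.Surjective b := by
    intro y
    obtain ⟨⟨y, hy⟩, rfl⟩ := N.mkQ_surjective y
    obtain ⟨x, hx, rfl⟩ := (Ideal.mem_map_iff_of_surjective _ Ideal.Quotient.mk_surjective).mp hy
    exact ⟨⟨x, hx⟩, rfl⟩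
  have hker : LinearMap.ker b =
      ((F (μ + 1) ⊔ filteredSum F ν g k μ).submoduleOf (F μ)).restrictScalars ℂ := by
    ext x
    rw [LinearMap.mem_ker]
    change N.mkQ (a x) = 0 ↔ (x : O) ∈ F (μ + 1) ⊔ filteredSum F ν g k μ
    rw [Submodule.mkQ_apply, Submodule.Quotient.mk_eq_zero]
    change Ideal.Quotient.mk I x ∈ (F (μ + 1)).map (Ideal.Quotient.mk I) ↔ _
    rw [Ideal.mem_map_iff_of_surjective _ Ideal.Quotient.mk_surjective]
    constructor
    · rintro ⟨y, hy, hxy⟩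
      have h1 : (x : O) - y ∈ filteredSum F ν g k μ :=
        h.inf_span_le μ ⟨sub_mem x.2 (h.add_one_le μ hy), Ideal.Quotient.eq.mp hxy.symm⟩
      have := Submodule.add_mem_sup hy h1
      rwa [add_sub_cancel] at this
    · intro hx
      obtain ⟨y, hy, s, hs, hx⟩ := Submodule.mem_sup.mp hx
      refine ⟨y, hy, ?_⟩
      rw [← hx, map_add, Ideal.Quotient.eq_zero_iff_mem.mpr (hI hs), add_zero]
  exact ⟨(Submodule.quotEquivOfEq _ _ hker.symm).trans (b.quotKerEquivOfSurjective hb)⟩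

end IsFilteredRegular

end HilbertFunction

/-- The quotient by an `O`-submodule is the image of a `ℂ`-linear map with that kernel. -/
def quotientEquivOfSurjective {O M V : Type*} [CommRing O] [Algebra ℂ O] [AddCommGroup M]
    [Module O M] [Module ℂ M] [IsScalarTower ℂ O M] [AddCommGroup V] [Module ℂ V]
    {N : Submodule O M} {b : M →ₗ[ℂ] V} (hker : LinearMap.ker b = N.restrictScalars ℂ)
    (hb : Function.Surjective b) : (M ⧸ N) ≃ₗ[ℂ] V :=
  (Submodule.quotEquivOfEq _ _ hker.symm).trans (b.quotKerEquivOfSurjective hb)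

section AmbientHilbertFunction

variable {n r : ℕ} {p : Fin r → Fin n → ℕ} (hp : ∀ j l, 0 < p j l)

/-- The coefficients of a germ at the exponents that contribute to `F_μ / F_{μ+𝟏}`. -/
def coeffMap (μ : Fin r → ℤ) :
    supportFiltration p μ →ₗ[ℂ] ((finite_gradedSupport hp μ).toFinset → ℂ) where
  toFun f q := germCoeff q (f : HoloGerm n)
  map_add' _ _ := funext fun _ => germCoeff_add _ _ _
  map_smul' _ _ := funext fun _ => germCoeff_smul _ _ _

theorem ker_coeffMap (μ : Fin r → ℤ) : LinearMap.ker (coeffMap hp μ) =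
    ((supportFiltration p (μ + 1)).submoduleOf (supportFiltration p μ)).restrictScalars ℂ := by
  ext x
  rw [LinearMap.mem_ker]
  change coeffMap hp μ x = 0 ↔ (x : HoloGerm n) ∈ supportFiltration p (μ + 1)
  constructor
  · intro hx q hq
    by_contra hle
    exact hq (congrFun hx ⟨q, (finite_gradedSupport hp μ).mem_toFinset.mpr ⟨x.2 q hq, hle⟩⟩)
  · intro hx
    ext q
    by_contra hq
    exact ((finite_gradedSupport hp μ).mem_toFinset.mp q.2).2 (hx q hq)

theorem coeffMap_surjective (μ : Fin r → ℤ) : Function.Surjective (coeffMap hp μ) := by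
  classical
  intro c
  have hmem : ∑ q, MvPolynomial.monomial (reesExponent p μ q.1) (c q) ∈ reesPiece p μ :=
    Submodule.sum_mem _ fun q _ => MvPolynomial.isWeightedHomogeneous_monomial _ _ _
      (weight_reesExponent p ((finite_gradedSupport hp μ).mem_toFinset.mp q.2).1)
  refine ⟨⟨_, reesToGerm_mem p hmem⟩, ?_⟩
  ext q
  have hq := (finite_gradedSupport hp μ).mem_toFinset.mp q.2
  refine (germCoeff_reesToGerm p hmem q.1).trans ?_
  rw [if_pos hq.1, MvPolynomial.coeff_sum, Finset.sum_eq_single q, MvPolynomial.coeff_monomial,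
    if_pos rfl]
  · intro q' _ hne
    rw [MvPolynomial.coeff_monomial, if_neg]
    intro heq
    apply hne
    ext1
    rw [← fstExponent_reesExponent p μ q'.1, heq, fstExponent_reesExponent]
  · simp

/-- The monomials `z^q` with `q` in `gradedSupport p μ` form a basis of `F_μ / F_{μ+𝟏}`. -/
theorem gradedPiece_supportFiltration_equiv (μ : Fin r → ℤ) :
    Nonempty (GradedPiece (supportFiltration (n := n) p) μ ≃ₗ[ℂ]
      ((finite_gradedSupport hp μ).toFinset → ℂ)) :=
  ⟨quotientEquivOfSurjective (ker_coeffMap hp μ) (coeffMap_surjective hp μ)⟩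

end AmbientHilbertFunction

/-! ### Poincaré series -/

section Poincare

variable {r : ℕ}

/-- `P` is the Poincaré series of the Laurent series `L = ∑ h(μ) t^μ`, i.e.
`(t₁⋯t_r - 1) P = (t₁ - 1)⋯(t_r - 1) L`. -/
def IsPoincareSeries (h : (Fin r → ℤ) → ℤ) (P : MvPowerSeries (Fin r) ℤ) : Prop :=
  ∀ μ : Fin r → ℤ, laurentCoeff P (μ - 1) - laurentCoeff P μ =
    ∑ S : Finset (Fin r), (-1) ^ Sᶜ.card * h fun j => μ j - if j ∈ S then 1 else 0

theorem laurentCoeff_sub (P Q : MvPowerSeries (Fin r) ℤ) (μ : Fin r → ℤ) :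
    laurentCoeff (P - Q) μ = laurentCoeff P μ - laurentCoeff Q μ := by
  rw [laurentCoeff, laurentCoeff, laurentCoeff]
  split_ifs <;> simp

theorem laurentCoeff_tPow_mul (a : Fin r → ℕ) (P : MvPowerSeries (Fin r) ℤ) (μ : Fin r → ℤ) :
    laurentCoeff (tPow a * P) μ = laurentCoeff P (μ - fun j => (a j : ℤ)) := by
  classical
  rw [laurentCoeff, laurentCoeff, tPow]
  by_cases h : ∀ j, 0 ≤ (μ - fun j => (a j : ℤ)) j
  · have h0 : ∀ j, 0 ≤ μ j := fun j => by
      have := h j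
      simp only [Pi.sub_apply] at this
      omega
    have hle : Finsupp.equivFunOnFinite.symm a ≤
        Finsupp.equivFunOnFinite.symm fun j => (μ j).toNat := fun j => by
      have := h j
      simp only [Pi.sub_apply] at this
      simp only [Finsupp.equivFunOnFinite_symm_apply_apply]
      omega
    rw [if_pos h, if_pos h0, MvPowerSeries.coeff_monomial_mul, if_pos hle, one_mul]
    congr 2
    ext j
    simp only [Finsupp.tsub_apply, Finsupp.equivFunOnFinite_symm_apply_apply, Pi.sub_apply]
    omega
  · rw [if_neg h]
    split_ifs with h0
    · rw [MvPowerSeries.coeff_monomial_mul, if_neg]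
      intro hle
      refine h fun j => ?_
      have := hle j
      have := h0 j
      simp only [Finsupp.equivFunOnFinite_symm_apply_apply, Pi.sub_apply] at *
      omega
    · rfl

theorem IsPoincareSeries.one_sub_tPow_mul {h h' : (Fin r → ℤ) → ℤ} {P : MvPowerSeries (Fin r) ℤ}
    (hP : IsPoincareSeries h P) {a : Fin r → ℕ}
    (hh : ∀ μ, h' μ = h μ - h (μ - fun j => (a j : ℤ))) :
    IsPoincareSeries h' ((1 - tPow a) * P) := by
  intro μ
  have h1 := hP μ
  have h2 := hP (μ - fun j => (a j : ℤ))
  rw [sub_mul, one_mul, laurentCoeff_sub, laurentCoeff_sub, laurentCoeff_tPow_mul,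
    laurentCoeff_tPow_mul, sub_sub_sub_comm, h1, sub_right_comm, h2, ← Finset.sum_sub_distrib]
  refine Finset.sum_congr rfl fun S _ => ?_
  rw [hh, ← mul_sub]
  congr 3
  ext j
  simp only [Pi.sub_apply]
  ring

variable {n : ℕ} (p : Fin r → Fin n → ℕ)

/-- The exponents `q`, supported in `s`, with `⟨p_j, q⟩ = μ_j` for all `j`. -/
def pairingFiber (s : Finset (Fin n)) (μ : Fin r → ℤ) : Set (Fin n →₀ ℕ) :=
  {q | q.support ⊆ s ∧ pairings p q = μ}

variable {p}

theorem finite_pairingFiber (hr : 0 < r) (hp : ∀ j l, 0 < p j l) (s : Finset (Fin n))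
    (μ : Fin r → ℤ) : (pairingFiber p s μ).Finite := by
  refine (finite_pairings_not_le hp (μ + 1)).subset fun q hq hle => ?_
  have := hle ⟨0, hr⟩
  rw [hq.2] at this
  simp at this

theorem pairings_single (l : Fin n) : pairings p (Finsupp.single l 1) = fun j => (p j l : ℤ) := by
  ext j
  simp [pairings, pairing_eq_weight, Finsupp.weight_single]

/-- An exponent supported in `s ∪ {l}` either is supported in `s` or becomes an exponent supported in
`s ∪ {l}` after lowering its `l`-th entry by one. -/
theorem ncard_pairingFiber_insert (hr : 0 < r) (hp : ∀ j l, 0 < p j l) {s : Finset (Fin n)}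
    {l : Fin n} (hl : l ∉ s) (μ : Fin r → ℤ) :
    (pairingFiber p (insert l s) μ).ncard = (pairingFiber p s μ).ncard +
      (pairingFiber p (insert l s) (μ - fun j => (p j l : ℤ))).ncard := by
  have hunion : pairingFiber p (insert l s) μ = pairingFiber p s μ ∪ (· + Finsupp.single l 1) ''
      pairingFiber p (insert l s) (μ - fun j => (p j l : ℤ)) := by
    ext q
    constructor
    · rintro ⟨hs, hq⟩
      by_cases h : q l = 0
      · refine Or.inl ⟨fun i hi => ?_, hq⟩
        rcases Finset.mem_insert.mp (hs hi) with rfl | h'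
        · exact absurd h (Finsupp.mem_support_iff.mp hi)
        · exact h'
      · have hle : Finsupp.single l 1 ≤ q := by
          rw [Finsupp.single_le_iff]
          omega
        refine Or.inr ⟨q - Finsupp.single l 1, ⟨Finsupp.support_tsub.trans hs, ?_⟩,
          tsub_add_cancel_of_le hle⟩
        rw [eq_sub_iff_add_eq, ← pairings_single, ← pairings_add, tsub_add_cancel_of_le hle, hq]
    · rintro (⟨hs, hq⟩ | ⟨q, ⟨hs, hq⟩, rfl⟩)
      · exact ⟨hs.trans (Finset.subset_insert _ _), hq⟩
      · refine ⟨?_, ?_⟩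
        · refine Finsupp.support_add.trans (Finset.union_subset hs ?_)
          exact Finsupp.support_single_subset.trans (by simp)
        · change pairings p (q + _) = _
          rw [pairings_add, pairings_single, hq, sub_add_cancel]
  rw [hunion, Set.ncard_union_eq _ (finite_pairingFiber hr hp _ _)
    ((finite_pairingFiber hr hp _ _).image _), Set.ncard_image_of_injective _ (add_left_injective _)]
  rw [Set.disjoint_left]
  rintro _ ⟨hs, -⟩ ⟨q, -, rfl⟩
  refine hl (hs (Finsupp.mem_support_iff.mpr ?_))
  simp

theorem pairingFiber_eq_empty (s : Finset (Fin n)) {μ : Fin r → ℤ} (h : ¬ ∀ j, 0 ≤ μ j) :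
    pairingFiber p s μ = ∅ := by
  rw [Set.eq_empty_iff_forall_notMem]
  rintro q ⟨-, hq⟩
  exact h fun j => hq ▸ pairings_nonneg p q j

theorem laurentCoeff_prod_invOfUnit (hr : 0 < r) (hp : ∀ j l, 0 < p j l) (s : Finset (Fin n))
    (μ : Fin r → ℤ) :
    laurentCoeff (∏ l ∈ s, MvPowerSeries.invOfUnit (1 - tPow fun j => p j l) 1) μ =
      ((pairingFiber p s μ).ncard : ℤ) := by
  classical
  induction s using Finset.induction_on generalizing μ with
  | empty =>
    rw [Finset.prod_empty, laurentCoeff, MvPowerSeries.coeff_one]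
    have hfib : pairingFiber p ∅ μ = if μ = 0 then {0} else ∅ := by
      ext q
      simp only [pairingFiber, Finset.subset_empty, Finsupp.support_eq_empty, Set.mem_ofPred_eq]
      constructor
      · rintro ⟨rfl, rfl⟩
        simp [pairings_zero]
      · split_ifs with h
        · rintro rfl
          exact ⟨rfl, by rw [pairings_zero, h]⟩
        · simp
    rw [hfib]
    by_cases h : μ = 0
    · subst h
      simp [Finsupp.ext_iff]
    · rw [if_neg h, Set.ncard_empty]
      split_ifs with h0 h1
      · exfalso
        apply h
        ext j
        have := DFunLike.congr_fun h1 j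
        have := h0 j
        simp only [Finsupp.equivFunOnFinite_symm_apply_apply, Finsupp.coe_zero,
          Pi.zero_apply] at *
        omega
      · rfl
      · rfl
  | insert l s hl ih =>
    set Q := ∏ l ∈ s, MvPowerSeries.invOfUnit (1 - tPow fun j => p j l) 1 with hQ
    set M : MvPowerSeries (Fin r) ℤ := fun m =>
      ((pairingFiber p (insert l s) fun j => (m j : ℤ)).ncard : ℤ) with hM
    -- `M` is the generating series for `s ∪ {l}`; it is shown to satisfy `(1 - t^{p^l}) M = Q`
    have hML : ∀ ρ, laurentCoeff M ρ = ((pairingFiber p (insert l s) ρ).ncard : ℤ) := by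
      intro ρ
      rw [laurentCoeff]
      split_ifs with h
      · change ((pairingFiber p (insert l s) _).ncard : ℤ) = _
        congr 3
        ext j
        simp only [Finsupp.equivFunOnFinite_symm_apply_apply]
        exact Int.toNat_of_nonneg (h j)
      · rw [pairingFiber_eq_empty _ h, Set.ncard_empty]
        rfl
    have hMQ : (1 - tPow fun j => p j l) * M = Q := by
      ext m
      have hcoeff : ∀ P : MvPowerSeries (Fin r) ℤ,
          MvPowerSeries.coeff m P = laurentCoeff P fun j => (m j : ℤ) := by
        intro P
        rw [laurentCoeff, if_pos fun j => Int.natCast_nonneg _]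
        congr 2
        ext j
        simp
      rw [hcoeff, hcoeff, ih, sub_mul, one_mul, laurentCoeff_sub, laurentCoeff_tPow_mul, hML, hML,
        ncard_pairingFiber_insert hr hp hl]
      push_cast
      ring
    have hinv : (1 - tPow fun j => p j l) *
        MvPowerSeries.invOfUnit (1 - tPow fun j => p j l) 1 = 1 := by
      refine MvPowerSeries.mul_invOfUnit _ _ ?_
      rw [map_sub, map_one, tPow, ← MvPowerSeries.coeff_zero_eq_constantCoeff_apply,
        MvPowerSeries.coeff_monomial, if_neg, sub_zero, Units.val_one]
      intro h
      have := DFunLike.congr_fun h ⟨0, hr⟩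
      simp only [Finsupp.coe_zero, Pi.zero_apply, Finsupp.equivFunOnFinite_symm_apply_apply] at this
      exact (hp _ _).ne this
    rw [Finset.prod_insert hl, ← hQ, ← hMQ, ← mul_assoc, mul_comm (MvPowerSeries.invOfUnit _ _),
      hinv, one_mul, hML]

/-- The coefficients of the product `∏ 1 / (1 - t^{p^l})` count the monomials of given weights. -/
theorem laurentCoeff_productSeries (hr : 0 < r) (hp : ∀ j l, 0 < p j l) (μ : Fin r → ℤ) :
    laurentCoeff (productSeries p) μ = ({q | pairings p q = μ}.ncard : ℤ) := by
  rw [productSeries, laurentCoeff_prod_invOfUnit hr hp]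
  congr 2
  ext q
  simp [pairingFiber]

open Classical in
/-- The expansion of `∏_j ([μ_j - 1 ≤ w_j] - [μ_j ≤ w_j]) = [w = μ - 𝟏]`. -/
theorem sum_neg_one_pow_mul_ite_le (μ w : Fin r → ℤ) :
    ∑ S : Finset (Fin r), (-1 : ℤ) ^ Sᶜ.card *
      (if (fun j => μ j - if j ∈ S then 1 else 0) ≤ w then 1 else 0) =
        if w = μ - 1 then 1 else 0 := by
  have h1 := Fintype.prod_add (fun j => if μ j - 1 ≤ w j then (1 : ℤ) else 0)
    fun j => -(if μ j ≤ w j then (1 : ℤ) else 0)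
  have h2 : ∏ j, ((if μ j - 1 ≤ w j then (1 : ℤ) else 0) + -(if μ j ≤ w j then (1 : ℤ) else 0)) =
      if w = μ - 1 then 1 else 0 := by
    have : ∀ j, ((if μ j - 1 ≤ w j then (1 : ℤ) else 0) + -(if μ j ≤ w j then (1 : ℤ) else 0)) =
        if w j = μ j - 1 then 1 else 0 := by
      intro j
      split_ifs <;> omega
    simp only [this, Finset.prod_ite_zero, Finset.prod_const_one, Finset.mem_univ, true_imp_iff,
      funext_iff, Pi.sub_apply, Pi.one_apply]
  rw [← h2, h1]
  refine Finset.sum_congr rfl fun S _ => ?_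
  rw [Finset.prod_neg, mul_left_comm]
  congr 1
  have hle : (∀ j, μ j - (if j ∈ S then 1 else 0) ≤ w j) ↔
      (∀ j ∈ S, μ j - 1 ≤ w j) ∧ ∀ j ∈ Sᶜ, μ j ≤ w j := by
    simp only [Finset.mem_compl, ← forall_and]
    refine forall_congr' fun j => ?_
    by_cases hj : j ∈ S <;> simp [hj]
  rw [Finset.prod_boole, Finset.prod_boole, Pi.le_def]
  simp only [hle]
  split_ifs <;> tauto

theorem isPoincareSeries_productSeries (hr : 0 < r) (hp : ∀ j l, 0 < p j l) :
    IsPoincareSeries (fun μ => ((gradedSupport p μ).ncard : ℤ)) (productSeries p) := by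
  classical
  intro μ
  set T := (finite_pairings_not_le hp (μ + 1)).toFinset with hT
  have hmemT : ∀ q, q ∈ T ↔ ¬ μ + 1 ≤ pairings p q := fun q => by
    rw [hT, Set.Finite.mem_toFinset]
    rfl
  have hfib : ∀ ρ ≤ μ, laurentCoeff (productSeries p) ρ =
      ∑ q ∈ T, if pairings p q = ρ then 1 else 0 := by
    intro ρ hρ
    have hset : {q | pairings p q = ρ} = (T.filter fun q => pairings p q = ρ : Set _) := by
      ext q
      rw [Finset.mem_coe, Finset.mem_filter, hmemT, Set.mem_ofPred_eq, iff_and_self]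
      rintro rfl hle
      have h1 := (hle.trans hρ) ⟨0, hr⟩
      simp at h1
    rw [laurentCoeff_productSeries hr hp, Finset.sum_boole, hset, Set.ncard_coe_finset]
  have hgr : ∀ S : Finset (Fin r),
      ((gradedSupport p fun j => μ j - if j ∈ S then 1 else 0).ncard : ℤ) =
        ∑ q ∈ T, ((if (fun j => μ j - if j ∈ S then 1 else 0) ≤ pairings p q then 1 else 0) -
          if (fun j => (μ + 1) j - if j ∈ S then 1 else 0) ≤ pairings p q then 1 else 0) := by
    intro S
    set ρ : Fin r → ℤ := fun j => μ j - if j ∈ S then 1 else 0 with hρ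
    have hρ1 : (fun j => (μ + 1) j - if j ∈ S then 1 else 0) = ρ + 1 := by
      ext j
      simp only [hρ, Pi.add_apply, Pi.one_apply]
      ring
    have hρμ : ρ ≤ μ := fun j => by
      change μ j - _ ≤ μ j
      split_ifs <;> omega
    have hite : ∀ q, ((if ρ ≤ pairings p q then 1 else 0) -
        if ρ + 1 ≤ pairings p q then 1 else 0 : ℤ) = if q ∈ gradedSupport p ρ then 1 else 0 := by
      intro q
      have hle : ρ + 1 ≤ pairings p q → ρ ≤ pairings p q :=
        (le_add_of_nonneg_right zero_le_one).trans
      have hmem : q ∈ gradedSupport p ρ ↔ ρ ≤ pairings p q ∧ ¬ ρ + 1 ≤ pairings p q := Iff.rfl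
      simp only [hmem]
      split_ifs <;> first | rfl | tauto
    rw [hρ1]
    simp only [hite]
    have hset : gradedSupport p ρ = (T.filter fun q => q ∈ gradedSupport p ρ : Set _) := by
      ext q
      rw [Finset.mem_coe, Finset.mem_filter, hmemT]
      exact ⟨fun h => ⟨fun hle => h.2 ((add_le_add_left hρμ 1).trans hle), h⟩, fun h => h.2⟩
    rw [Finset.sum_boole, ← Set.ncard_coe_finset, ← hset]
  rw [hfib _ (sub_le_self _ zero_le_one), hfib _ le_rfl, ← Finset.sum_sub_distrib]
  simp only [hgr, Finset.mul_sum]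
  rw [Finset.sum_comm]
  refine Finset.sum_congr rfl fun q _ => ?_
  simp only [mul_sub, Finset.sum_sub_distrib]
  rw [sum_neg_one_pow_mul_ite_le, sum_neg_one_pow_mul_ite_le, add_sub_cancel_right]

end Poincare

/-! ### Positivity of the normal vectors -/

section Positivity

variable {n : ℕ}

theorem add_single_mem_newtonPolyhedron {f : HoloGerm n} {x : Fin n → ℝ}
    (hx : x ∈ newtonPolyhedron f) (l : Fin n) {t : ℝ} (ht : 0 ≤ t) :
    Pi.single l t + x ∈ newtonPolyhedron f := by
  have hconv : Convex ℝ ((fun y : Fin n → ℝ => Pi.single l t + y) ⁻¹' newtonPolyhedron f) :=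
    (convex_convexHull ℝ _).translate_preimage_right _
  refine convexHull_min (fun y hy => ?_) hconv hx
  obtain ⟨q, hq, hle⟩ := hy
  refine subset_convexHull ℝ _ ⟨q, hq, fun i => (hle i).trans ?_⟩
  have h0 : (0 : Fin n → ℝ) ≤ Pi.single l t := Pi.single_nonneg.mpr ht
  exact le_add_of_nonneg_left (h0 i)

/-- If `p_l = 0`, the face on which `p` is minimal is invariant under translations in the direction
of the `l`-th coordinate axis, hence not compact. -/
theorem pos_of_mem_compactFacetNormals {f : HoloGerm n} {p : Fin n → ℕ}
    (hp : p ∈ compactFacetNormals (newtonPolyhedron f)) (l : Fin n) : 0 < p l := by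
  obtain ⟨-, ⟨x, hx, hmin⟩, hcpt, -⟩ := hp
  by_contra h0
  have hpl : p l = 0 := by omega
  obtain ⟨C, hC⟩ := (hcpt.image (continuous_apply l)).bddAbove
  have hmem : Pi.single l (|C - x l| + 1) + x ∈ face (newtonPolyhedron f) p := by
    refine ⟨add_single_mem_newtonPolyhedron hx l (by positivity), fun y hy => ?_⟩
    refine le_of_eq_of_le ?_ (hmin y hy)
    refine Finset.sum_congr rfl fun i _ => ?_
    rcases eq_or_ne i l with rfl | hi
    · simp [hpl]
    · simp [Pi.single_eq_of_ne hi]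
  have h1 := hC ⟨_, hmem, rfl⟩
  simp only [Pi.add_apply, Pi.single_eq_same] at h1
  linarith [le_abs_self (C - x l)]

end Positivity

/-! ### The Poincaré series of both filtrations -/

section Filtrations

/-- For `r = 0` the indices `μ` and `μ + 𝟏` agree, so all graded pieces vanish. -/
theorem hasPoincareSeries_of_isEmpty {A : Type*} [CommRing A] [Algebra ℂ A]
    (F : (Fin 0 → ℤ) → Ideal A) (P : MvPowerSeries (Fin 0) ℤ) : HasPoincareSeries F P := by
  have hsub : ∀ μ, Subsingleton (GradedPiece F μ) := fun μ => by
    rw [Submodule.Quotient.subsingleton_iff, Subsingleton.elim (μ + 1) μ,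
      Submodule.submoduleOf_self]
  refine ⟨fun μ => ?_, fun μ => ?_⟩
  · have := hsub μ
    infer_instance
  · rw [Subsingleton.elim (μ - 1) μ, sub_self]
    refine (Finset.sum_eq_zero fun S _ => ?_).symm
    have := hsub fun j => μ j - if j ∈ S then 1 else 0
    rw [Module.finrank_zero_of_subsingleton, Nat.cast_zero, mul_zero]

/-- The Poincaré series of the induced filtration on the quotient by a regular sequence is that of the
graded pieces divided by the classes of the equations. -/
theorem IsFilteredRegular.hasPoincareSeries_map {O : Type*} [CommRing O] [Algebra ℂ O] {r k : ℕ}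
    {F : (Fin r → ℤ) → Ideal O} {ν : Fin k → Fin r → ℤ} {g : Fin k → O}
    (h : IsFilteredRegular F ν g) (hfin : ∀ μ, Module.Finite ℂ (GradedPiece F μ))
    {P : MvPowerSeries (Fin r) ℤ}
    (hP : IsPoincareSeries (fun μ => (Module.finrank ℂ (FilteredQuotient F ν g k μ) : ℤ)) P) :
    HasPoincareSeries (A := O ⧸ Ideal.span (Set.range g))
      (fun μ => (F μ).map (Ideal.Quotient.mk (Ideal.span (Set.range g)))) P := by
  refine ⟨fun μ => ?_, fun μ => (hP μ).trans (Finset.sum_congr rfl fun S _ => ?_)⟩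
  · have := h.finite_filteredQuotient hfin le_rfl μ
    exact Module.Finite.equiv (h.gradedPiece_equiv μ).some
  · dsimp only
    rw [(h.gradedPiece_equiv _).some.finrank_eq]

variable {n r k : ℕ} {p : Fin r → Fin n → ℕ} (hp : ∀ j l, 0 < p j l)

include hp

theorem finite_gradedPiece_supportFiltration (μ : Fin r → ℤ) :
    Module.Finite ℂ (GradedPiece (supportFiltration (n := n) p) μ) :=
  Module.Finite.equiv (gradedPiece_supportFiltration_equiv hp μ).some.symm

theorem finrank_gradedPiece_supportFiltration (μ : Fin r → ℤ) :
    Module.finrank ℂ (GradedPiece (supportFiltration (n := n) p) μ) =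
      (gradedSupport p μ).ncard := by
  rw [(gradedPiece_supportFiltration_equiv hp μ).some.finrank_eq, Module.finrank_fintype_fun_eq_card,
    Fintype.card_coe, Set.ncard_eq_toFinset_card _ (finite_gradedSupport hp μ)]

theorem hasPoincareSeries_ambientFiltration (hr : 0 < r) :
    HasPoincareSeries (ambientFiltration (n := n) p) (productSeries p) := by
  have hF : ambientFiltration (n := n) p = supportFiltration p := funext (ambientFiltration_eq p hp)
  rw [hF]
  refine ⟨finite_gradedPiece_supportFiltration hp, fun μ => ?_⟩
  simp only [finrank_gradedPiece_supportFiltration hp]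
  exact isPoincareSeries_productSeries hr hp μ

theorem isFilteredRegular_supportFiltration (hr : 0 < r) (g : Fin k → HoloGerm n)
    (hg0 : ∀ i, germCoeff 0 (g i) = 0)
    (hcodim : ∀ J : Finset (Fin r), J.Nonempty →
      CodimAtLeast (Ideal.span (Set.range fun i => initialPart p J (g i)))
        ((k : ℤ) - J.card + 1)) :
    IsFilteredRegular (supportFiltration p) (fun i => weightOrders p (g i)) g where
  antitone := supportFiltration_antitone p
  mul_mem := mul_mem_supportFiltration p
  eq_top := supportFiltration_eq_top p
  mem i := mem_supportFiltration_weightOrders p (g i)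
  regular i _ _ hx h := mem_sup_of_mul_mem hp hr g hg0 hcodim i hx h

theorem isPoincareSeries_filteredQuotient (hr : 0 < r) {g : Fin k → HoloGerm n}
    (hreg : IsFilteredRegular (supportFiltration p) (fun i => weightOrders p (g i)) g) {i : ℕ}
    (hi : i ≤ k) :
    IsPoincareSeries (fun μ => (Module.finrank ℂ (FilteredQuotient (supportFiltration p)
        (fun i => weightOrders p (g i)) g i μ) : ℤ))
      ((∏ l ∈ Finset.univ.filter (fun l : Fin k => (l : ℕ) < i), (1 - tPow fun j => weightOrder (p j) (g l))) *
        productSeries p) := by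
  induction i with
  | zero =>
    have h0 : ∀ μ, Module.finrank ℂ (FilteredQuotient (supportFiltration p)
        (fun i => weightOrders p (g i)) g 0 μ) = (gradedSupport p μ).ncard := fun μ => by
      rw [(filteredQuotientZeroEquiv _ _ _ μ).finrank_eq, finrank_gradedPiece_supportFiltration hp]
    simp only [h0, Nat.not_lt_zero, Finset.filter_false, Finset.prod_empty, one_mul]
    exact isPoincareSeries_productSeries hr hp
  | succ i ih =>
    have hfilter : Finset.univ.filter (fun l : Fin k => (l : ℕ) < i + 1) =
        insert ⟨i, hi⟩ (Finset.univ.filter fun l : Fin k => (l : ℕ) < i) := by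
      ext l
      simp only [Finset.mem_filter, Finset.mem_univ, true_and, Finset.mem_insert, Fin.ext_iff]
      omega
    rw [hfilter, Finset.prod_insert (by simp), mul_assoc]
    refine (ih (by omega)).one_sub_tPow_mul fun μ => ?_
    have := (hreg.finite_and_finrank_succ ⟨i, hi⟩ μ (hreg.finite_filteredQuotient
      (finite_gradedPiece_supportFiltration hp) (by omega : i ≤ k) μ)).2
    simp only at this
    rw [this, Nat.cast_add]
    exact (add_sub_cancel_right _ _).symm

theorem hasPoincareSeries_inducedFiltration (hr : 0 < r) (g : Fin k → HoloGerm n)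
    (hg0 : ∀ i, germCoeff 0 (g i) = 0)
    (hcodim : ∀ J : Finset (Fin r), J.Nonempty →
      CodimAtLeast (Ideal.span (Set.range fun i => initialPart p J (g i)))
        ((k : ℤ) - J.card + 1)) :
    HasPoincareSeries (A := LocalRingOf g) (inducedFiltration p g)
      ((∏ i : Fin k, (1 - tPow fun j => weightOrder (p j) (g i))) * productSeries p) := by
  have hreg := isFilteredRegular_supportFiltration hp hr g hg0 hcodim
  have hF : inducedFiltration p g =
      fun μ => (supportFiltration p μ).map (Ideal.Quotient.mk (Ideal.span (Set.range g))) :=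
    funext fun μ => by rw [inducedFiltration, ambientFiltration_eq p hp]
  rw [hF]
  refine hreg.hasPoincareSeries_map (finite_gradedPiece_supportFiltration hp) ?_
  simpa using isPoincareSeries_filteredQuotient hp hr hreg le_rfl

end Filtrations

end NewtonFiltration

end

theorem theorem1p1 {n k r : ℕ} (hk : 0 < k) (g : Fin k → NewtonFiltration.HoloGerm n)
    (hconv : ∀ i, NewtonFiltration.IsConvenient (g i))
    (hci : NewtonFiltration.IsCompleteIntersection g)
    (p : Fin r → Fin n → ℕ) (hp_inj : Function.Injective p)
    (hp_range : Set.range p = NewtonFiltration.compactFacetNormals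
      (NewtonFiltration.newtonPolyhedron (∏ i, g i)))
    (hcodim : ∀ J : Finset (Fin r), J.Nonempty →
      NewtonFiltration.CodimAtLeast
        (Ideal.span (Set.range fun i => NewtonFiltration.initialPart p J (g i)))
        ((k : ℤ) - J.card + 1)) :
    NewtonFiltration.HasPoincareSeries (NewtonFiltration.ambientFiltration p)
        (NewtonFiltration.productSeries p) ∧
      NewtonFiltration.HasPoincareSeries (A := NewtonFiltration.LocalRingOf g)
        (NewtonFiltration.inducedFiltration p g)
        ((∏ i : Fin k, (1 - NewtonFiltration.tPow fun l =>
            NewtonFiltration.weightOrder (p l) (g i))) *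
          NewtonFiltration.productSeries p) := by
  rcases Nat.eq_zero_or_pos r with rfl | hr
  · exact ⟨NewtonFiltration.hasPoincareSeries_of_isEmpty _ _,
      NewtonFiltration.hasPoincareSeries_of_isEmpty _ _⟩
  · have hp : ∀ j l, 0 < p j l := fun j l =>
      NewtonFiltration.pos_of_mem_compactFacetNormals
        (hp_range ▸ Set.mem_range_self j : p j ∈ _) l
    exact ⟨NewtonFiltration.hasPoincareSeries_ambientFiltration hp hr,
      NewtonFiltration.hasPoincareSeries_inducedFiltration hp hr g hci.1 hcodim⟩
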